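/- Fix a number $n \ge 1$ of bins and an offset function $f:\mathbb{N}\to[0,\infty)$. The $\textsc{Relative-Threshold}(f(n))$ process starts with the empty load vector $x^0=(0,\dots,0)$. In each round $t = 0,1,2,\dots$ it samples two bins $i_1,i_2\in\{1,\dots,n\}$ independently and uniformly at random, independently of the earlier rounds, and places one ball: into bin $i_1$ if $x^t_{i_1} < \frac tn + f(n)$, and into bin $i_2$ otherwise. Let $x^t\in\mathbb{N}^n$ be the load vector after $t$ rounds and let $$\mathrm{Gap}(t) = \max_{1\le i\le n} x_i^t - \frac1n\sum_{i=1}^n x_i^t = \max_{1\le i\le n} x_i^t-\frac tn .$$ **Theorem.** There is an absolute constant $\kappa>0$ such that for every function $f:\mathbb{N}\to[0,\infty)$, every $n\ge 1$ and every round $m\ge 0$, the $\textsc{Relative-Threshold}(f(n))$ process with $n$ bins satisfies $$\Pr\bigl[\mathrm{Gap}(m)\le \kappa\,(\log n+f(n))\bigr]\ \ge\ 1-n^{-4}.$$ -/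

import Mathlib

open MeasureTheory

namespace BalancedAllocation

/-- A load vector: the number of balls in each of the `n` bins. -/
abbrev LoadVector (n : ℕ) : Type := Fin n → ℕ

/-- The samples `(i₁, i₂)` taken in the rounds `t = 0, 1, 2, …`. -/
abbrev Samples (n : ℕ) : Type := ℕ → Fin n × Fin n

/-- One step of Two-Thinning with current load vector `x`, threshold `θ` and samples
`i = (i₁, i₂)`: the ball goes to `i₁` if the load of `i₁` is below `θ`, otherwise to `i₂`. -/
noncomputable def thinningStep {n : ℕ} (θ : ℝ) (x : LoadVector n) (i : Fin n × Fin n) :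
    LoadVector n :=
  open Classical in if (x i.1 : ℝ) < θ then x + Pi.single i.1 1 else x + Pi.single i.2 1

/-- The load vector `x^t` after `t` rounds of Two-Thinning, started with empty bins, when the
samples are `s`. The threshold `θ t x` of a round may depend on the number `t` of rounds
completed so far and on the current load vector `x`. -/
noncomputable def twoThinning {n : ℕ} (θ : ℕ → LoadVector n → ℝ) (s : Samples n) :
    ℕ → LoadVector n
  | 0 => 0
  | t + 1 => thinningStep (θ t (twoThinning θ s t)) (twoThinning θ s t) (s t)

/-- The Relative-Threshold process: Two-Thinning with threshold `t / n + a` in round `t`,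
where `a` is the offset `f(n)`. -/
noncomputable def relativeThreshold {n : ℕ} (a : ℝ) (s : Samples n) : ℕ → LoadVector n :=
  twoThinning (fun t _ => (t : ℝ) / (n : ℝ) + a) s

/-- The gap of a load vector: maximum load minus mean load. -/
noncomputable def gap {n : ℕ} [NeZero n] (x : LoadVector n) : ℝ :=
  ((Finset.univ.sup' Finset.univ_nonempty x : ℕ) : ℝ) - ((∑ i, x i : ℕ) : ℝ) / (n : ℝ)

/-- The law of the samples: independent over the rounds, and uniform on pairs of bins in every
round (so the two samples of a round are independent and uniform on the bins). -/
noncomputable def sampleLaw (n : ℕ) [NeZero n] : Measure (Samples n) :=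
  Measure.infinitePi fun _ : ℕ => (PMF.uniformOfFintype (Fin n × Fin n)).toMeasure

end BalancedAllocation

/-! Write z_i = x_i - t/n - a with a = f(n); the average of z is always -a. If d is the fraction of
bins with z < 0, such a bin receives the ball with probability (2 - d)/n and any other bin with
probability (1 - d)/n. Bins above the threshold are thus pulled down at rate d and bins below it
pulled up at rate 1 - d. For g of order 1/(a + 1), let P and Q be the averages of exp(g z) and
exp(-g z). Their product need not contract when d is near 0 or 1, where the process is almost
One-Choice. But if the bins are then close to the threshold on average, variance makes a quadratic
potential grow. `potential` therefore multiplies P Q by exp(-50000 g^2 H), with H the mean of a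
Huber function, whose linear tails keep its change per round small. A first-order bound for the
change of the logarithm has drift at most -617 g^2/n once the potential is at least 4
(`stepMean_totalChange_le_of_le`), and the damping costs only a power: P + Q is at most 16 times the
squared potential (`expMean_add_expMean_neg_le`).

Markov's inequality bounds the potential polynomially in n, so loads are O((a + 1) log n), which
settles bounded a (`measureReal_exists_lt_relLoad_le`). Two regimes remain.

For n ≤ a + 1, the product of the potential and a one-sided exponential average with the larger
exponent b of order g √a still contracts. Since log n = O(√a), loads are O(a)
(`measureReal_exists_lt_relLoad_le_of_le_offset`).

For a + 1 ≤ n with n large, the polynomial bound over a window of rounds shows that for the exponent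
g/42 every bin has a share O(1/√n) of P and Q. Powers of order log n of the potential then have
bounded expectation, so the potential itself is bounded throughout a shorter window
(`measureReal_staysIn_and_le_potential`). As Q is bounded and the average shortfall is at least a,
Cauchy–Schwarz forces a constant fraction of bins below the threshold. An exponential average with a
constant exponent now contracts, and loads are O(log n) (`measureReal_staysIn_and_exists_lt`). -/

namespace BalancedAllocation

/-! ### One step: averages, increments and exponential averages -/

section OneStep

variable {n : ℕ}

/-- The average of a function over the bins. -/
noncomputable def mean (g : Fin n → ℝ) : ℝ := (∑ i, g i) / n

lemma mean_mono {g h : Fin n → ℝ} (hgh : ∀ i, g i ≤ h i) : mean g ≤ mean h :=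
  div_le_div_of_nonneg_right (Finset.sum_le_sum fun i _ => hgh i) (Nat.cast_nonneg n)

lemma mean_nonneg {g : Fin n → ℝ} (hg : ∀ i, 0 ≤ g i) : 0 ≤ mean g :=
  div_nonneg (Finset.sum_nonneg fun i _ => hg i) (Nat.cast_nonneg n)

lemma mean_add (g h : Fin n → ℝ) : mean (fun i => g i + h i) = mean g + mean h := by
  simp [mean, Finset.sum_add_distrib, add_div]

lemma mean_sub (g h : Fin n → ℝ) : mean (fun i => g i - h i) = mean g - mean h := by
  simp [mean, Finset.sum_sub_distrib, sub_div]

lemma mean_mul_left (c : ℝ) (g : Fin n → ℝ) : mean (fun i => c * g i) = c * mean g := by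
  simp [mean, ← Finset.mul_sum, mul_div_assoc]

lemma mean_const [NeZero n] (c : ℝ) : mean (fun _ : Fin n => c) = c := by
  have : (n : ℝ) ≠ 0 := Nat.cast_ne_zero.2 (NeZero.ne n)
  simp [mean, this]

lemma le_card_mul_mean [NeZero n] {g : Fin n → ℝ} (hg : ∀ i, 0 ≤ g i) (i : Fin n) :
    g i ≤ n * mean g := by
  have : (n : ℝ) ≠ 0 := Nat.cast_ne_zero.2 (NeZero.ne n)
  rw [mean, mul_div_cancel₀ _ this]
  exact Finset.single_le_sum (fun i _ => hg i) (Finset.mem_univ i)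

/-- The indicator of a bin being below the threshold. -/
noncomputable def below (z : Fin n → ℝ) (i : Fin n) : ℝ := if z i < 0 then 1 else 0

lemma below_nonneg (z : Fin n → ℝ) (i : Fin n) : 0 ≤ below z i := by
  unfold below; split_ifs <;> norm_num

lemma below_le_one (z : Fin n → ℝ) (i : Fin n) : below z i ≤ 1 := by
  unfold below; split_ifs <;> norm_num

/-- The fraction of bins below the threshold. -/
noncomputable def fracBelow (z : Fin n → ℝ) : ℝ := mean (below z)

lemma fracBelow_nonneg (z : Fin n → ℝ) : 0 ≤ fracBelow z := mean_nonneg (below_nonneg z)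

lemma fracBelow_le_one [NeZero n] (z : Fin n → ℝ) : fracBelow z ≤ 1 :=
  (mean_mono (below_le_one z)).trans_eq (mean_const 1)

/-- The probability that the next ball is placed into bin `k`, when `z` are the loads relative to
the threshold. -/
noncomputable def weight (z : Fin n → ℝ) (k : Fin n) : ℝ := (below z k + (1 - fracBelow z)) / n

lemma weight_nonneg [NeZero n] (z : Fin n → ℝ) (k : Fin n) : 0 ≤ weight z k :=
  div_nonneg (add_nonneg (below_nonneg z k) (sub_nonneg.2 (fracBelow_le_one z)))
    (Nat.cast_nonneg n)

lemma sum_weight [NeZero n] (z : Fin n → ℝ) : ∑ k, weight z k = 1 := by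
  have : mean (fun k => below z k + (1 - fracBelow z)) = 1 := by
    rw [mean_add, mean_const]; simp [fracBelow]
  simpa [weight, mean, Finset.sum_div] using this

lemma weight_le [NeZero n] (z : Fin n → ℝ) (k : Fin n) : weight z k ≤ 2 / n :=
  div_le_div_of_nonneg_right
    (by linarith [below_le_one z k, fracBelow_nonneg z]) (Nat.cast_nonneg n)

/-- The expectation over the bin `k` that receives the next ball. -/
noncomputable def stepMean (z : Fin n → ℝ) (g : Fin n → ℝ) : ℝ := ∑ k, weight z k * g k

lemma stepMean_mono [NeZero n] (z : Fin n → ℝ) {g h : Fin n → ℝ} (hgh : ∀ i, g i ≤ h i) :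
    stepMean z g ≤ stepMean z h :=
  Finset.sum_le_sum fun k _ => mul_le_mul_of_nonneg_left (hgh k) (weight_nonneg z k)

lemma stepMean_add (z g h : Fin n → ℝ) :
    stepMean z (fun k => g k + h k) = stepMean z g + stepMean z h := by
  simp [stepMean, mul_add, Finset.sum_add_distrib]

lemma stepMean_sub (z g h : Fin n → ℝ) :
    stepMean z (fun k => g k - h k) = stepMean z g - stepMean z h := by
  simp [stepMean, mul_sub, Finset.sum_sub_distrib]

lemma stepMean_mul_left (z : Fin n → ℝ) (c : ℝ) (g : Fin n → ℝ) :
    stepMean z (fun k => c * g k) = c * stepMean z g := by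
  simp [stepMean, Finset.mul_sum, mul_left_comm]

lemma stepMean_const [NeZero n] (z : Fin n → ℝ) (c : ℝ) : stepMean z (fun _ => c) = c := by
  simp [stepMean, ← Finset.sum_mul, sum_weight]

lemma stepMean_le [NeZero n] (z : Fin n → ℝ) {g : Fin n → ℝ} (hg : ∀ i, 0 ≤ g i) :
    stepMean z g ≤ 2 * mean g := by
  rw [mean, ← mul_div_assoc, mul_div_right_comm, Finset.mul_sum]
  exact Finset.sum_le_sum fun k _ => mul_le_mul_of_nonneg_right (weight_le z k) (hg k)

/-- The increment of the relative load of bin `j` when bin `k` receives the ball. -/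
noncomputable def incr (k j : Fin n) : ℝ := (if j = k then 1 else 0) - 1 / n

/-- The relative loads after bin `k` has received a ball. -/
noncomputable def shift (z : Fin n → ℝ) (k : Fin n) : Fin n → ℝ := fun j => z j + incr k j

lemma abs_incr_le (k j : Fin n) : |incr k j| ≤ (if j = k then 1 else 0) + 1 / n := by
  unfold incr
  refine (abs_sub _ _).trans (add_le_add ?_ ?_)
  · split_ifs <;> simp
  · rw [abs_of_nonneg (by positivity)]

lemma abs_incr_le_one [NeZero n] (k j : Fin n) : |incr k j| ≤ 1 := by
  have h1 : (1 : ℝ) ≤ n := by exact_mod_cast NeZero.one_le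
  have h2 : (1 : ℝ) / n ≤ 1 := by rw [div_le_one (by linarith)]; exact h1
  have h3 : (0 : ℝ) ≤ 1 / n := by positivity
  unfold incr
  rw [abs_le]; split_ifs <;> constructor <;> linarith

lemma stepMean_incr [NeZero n] (z : Fin n → ℝ) (j : Fin n) :
    stepMean z (fun k => incr k j) = weight z j - 1 / n := by
  unfold incr
  rw [stepMean_sub, stepMean_const]
  simp [stepMean]

/-- The expected increment of a bin has the sign of its pull towards the threshold: (1 - d)/n below
it and -d/n otherwise. -/
lemma weight_sub [NeZero n] (z : Fin n → ℝ) (j : Fin n) :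
    weight z j - 1 / n = (below z j - fracBelow z) / n := by
  rw [weight, ← sub_div]; ring

lemma stepMean_incr_sq_le [NeZero n] (z : Fin n → ℝ) (j : Fin n) :
    stepMean z (fun k => incr k j ^ 2) ≤ 3 / n := by
  have h1 : (1 : ℝ) ≤ n := by exact_mod_cast NeZero.one_le
  have h0 : (0 : ℝ) ≤ 1 / n := by positivity
  have h2 : (1 : ℝ) / n ≤ 1 := by rw [div_le_one (by linarith)]; exact h1
  have h : ∀ k, incr k j ^ 2 ≤ (if j = k then 1 else 0) + 1 / n := by
    intro k
    unfold incr
    split_ifs <;> nlinarith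
  refine (stepMean_mono z h).trans ?_
  rw [stepMean_add, stepMean_const]
  have := weight_le z j
  have h3 : (3 : ℝ) / n = 2 / n + 1 / n := by ring
  simp only [stepMean, mul_ite, mul_one, mul_zero, Finset.sum_ite_eq, Finset.mem_univ, if_true]
  linarith

/-- Only the event that bin `j` itself receives the ball is kept; its increment 1 - 1/n is at least
1/2. -/
lemma le_stepMean_incr_sq [NeZero n] (hn : 2 ≤ n) (z : Fin n → ℝ) (j : Fin n) :
    weight z j / 4 ≤ stepMean z (fun k => incr k j ^ 2) := by
  have h2 : (1 : ℝ) / n ≤ 1 / 2 := by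
    have : (2 : ℝ) ≤ n := by exact_mod_cast hn
    exact one_div_le_one_div_of_le (by norm_num) this
  have h : weight z j * incr j j ^ 2 ≤ stepMean z (fun k => incr k j ^ 2) :=
    Finset.single_le_sum (f := fun k => weight z k * incr k j ^ 2)
      (fun k _ => mul_nonneg (weight_nonneg z k) (sq_nonneg _)) (Finset.mem_univ j)
  refine le_trans ?_ h
  have : (1 : ℝ) / 4 ≤ incr j j ^ 2 := by
    simp only [incr, if_true]; nlinarith
  have := mul_le_mul_of_nonneg_left this (weight_nonneg z j)
  linarith

lemma mean_shift [NeZero n] (z : Fin n → ℝ) (k : Fin n) : mean (shift z k) = mean z := by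
  have : (n : ℝ) ≠ 0 := Nat.cast_ne_zero.2 (NeZero.ne n)
  unfold shift incr
  rw [mean_add, mean_sub, mean_const]
  simp [mean]

/-! ### Exponential potentials -/

/-- The average of `exp (b * z i)` over the bins. -/
noncomputable def expMean (b : ℝ) (z : Fin n → ℝ) : ℝ := mean fun i => Real.exp (b * z i)

lemma expMean_pos [NeZero n] (b : ℝ) (z : Fin n → ℝ) : 0 < expMean b z :=
  div_pos (Finset.sum_pos (fun _ _ => Real.exp_pos _) Finset.univ_nonempty)
    (Nat.cast_pos.2 (NeZero.pos n))

lemma exp_le_expMean [NeZero n] (b : ℝ) (z : Fin n → ℝ) (i : Fin n) :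
    Real.exp (b * z i) ≤ n * expMean b z :=
  le_card_mul_mean (g := fun i => Real.exp (b * z i)) (fun _ => (Real.exp_pos _).le) i

/-- Convexity of the exponential: the average of `exp` dominates `exp` of the average. -/
lemma exp_mean_le_expMean [NeZero n] (b : ℝ) (z : Fin n → ℝ) :
    Real.exp (b * mean z) ≤ expMean b z := by
  -- Tangent line of `exp` at `b * mean z`; its average is its value at that point.
  have h : ∀ i, Real.exp (b * mean z) * (1 + (b * z i - b * mean z)) ≤ Real.exp (b * z i) := by
    intro i
    have := Real.add_one_le_exp (b * z i - b * mean z)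
    calc _ ≤ Real.exp (b * mean z) * Real.exp (b * z i - b * mean z) := by
          gcongr; linarith
      _ = _ := by rw [← Real.exp_add]; ring_nf
  refine le_trans (le_of_eq ?_) (mean_mono h)
  rw [mean_mul_left, mean_add, mean_sub, mean_mul_left, mean_const, mean_const]
  ring

/-- The relative change of `expMean b` when bin `k` receives the ball. -/
noncomputable def relChange (b : ℝ) (z : Fin n → ℝ) (k : Fin n) : ℝ :=
  expMean b (shift z k) / expMean b z - 1

lemma expMean_shift [NeZero n] (b : ℝ) (z : Fin n → ℝ) (k : Fin n) :
    expMean b (shift z k) = expMean b z * (1 + relChange b z k) := by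
  have := (expMean_pos b z).ne'
  unfold relChange; field_simp; ring

lemma relChange_eq [NeZero n] (b : ℝ) (z : Fin n → ℝ) (k : Fin n) :
    relChange b z k =
      mean (fun j => Real.exp (b * z j) * (Real.exp (b * incr k j) - 1)) / expMean b z := by
  have := (expMean_pos b z).ne'
  rw [relChange, div_sub_one this, expMean, expMean, ← mean_sub]
  congr 2
  ext j
  rw [shift, mul_add, Real.exp_add]; ring

lemma abs_exp_sub_one_le {x : ℝ} (hx : |x| ≤ 1) : |Real.exp x - 1| ≤ 2 * |x| :=
  Real.abs_exp_sub_one_le hx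

lemma exp_le_one_add_add_sq {x : ℝ} (hx : |x| ≤ 1) : Real.exp x ≤ 1 + x + x ^ 2 := by
  have := (abs_le.1 (Real.abs_exp_sub_one_sub_id_le hx)).2
  linarith

lemma abs_relChange_le [NeZero n] {b : ℝ} (hb : |b| ≤ 1) (z : Fin n → ℝ) (k : Fin n) :
    |relChange b z k| ≤ 2 * |b| * (Real.exp (b * z k) / (n * expMean b z) + 1 / n) := by
  have hP := expMean_pos b z
  have hn : (0 : ℝ) < n := Nat.cast_pos.2 (NeZero.pos n)
  have h1 : ∀ j, |Real.exp (b * z j) * (Real.exp (b * incr k j) - 1)| ≤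
      2 * |b| * (Real.exp (b * z j) * (if j = k then 1 else 0) + 1 / n * Real.exp (b * z j)) := by
    intro j
    rw [abs_mul, abs_of_pos (Real.exp_pos _)]
    have h2 : |b * incr k j| ≤ 1 := by
      rw [abs_mul]; exact mul_le_one₀ hb (abs_nonneg _) (abs_incr_le_one k j)
    have h3 := abs_exp_sub_one_le h2
    rw [abs_mul] at h3
    calc _ ≤ Real.exp (b * z j) * (2 * (|b| * ((if j = k then 1 else 0) + 1 / n))) := by
          gcongr
          exact h3.trans (by gcongr; exact abs_incr_le k j)
      _ = _ := by ring
  rw [relChange_eq, abs_div, abs_of_pos hP, div_le_iff₀ hP]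
  calc _ ≤ mean (fun j => 2 * |b| * (Real.exp (b * z j) * (if j = k then 1 else 0)
          + 1 / n * Real.exp (b * z j))) := by
        unfold mean
        rw [abs_div, abs_of_pos hn]
        gcongr
        exact (Finset.abs_sum_le_sum_abs _ _).trans (Finset.sum_le_sum fun j _ => h1 j)
    _ = 2 * |b| * (Real.exp (b * z k) / n + 1 / n * expMean b z) := by
        rw [mean_mul_left, mean_add, mean_mul_left]
        congr 2
        simp [mean]
    _ = _ := by field_simp

lemma stepMean_mean (z : Fin n → ℝ) (g : Fin n → Fin n → ℝ) :
    stepMean z (fun k => mean (g k)) = mean fun j => stepMean z fun k => g k j := by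
  unfold stepMean mean
  rw [Finset.sum_comm, Finset.sum_div]
  refine Finset.sum_congr rfl fun k _ => ?_
  rw [← Finset.mul_sum, mul_div_assoc]

/-- The expected relative change of an exponential potential. -/
lemma stepMean_relChange_le [NeZero n] {b : ℝ} (hb : |b| ≤ 1) (z : Fin n → ℝ) :
    stepMean z (relChange b z) ≤
      (3 * b ^ 2 + b * (mean (fun j => Real.exp (b * z j) * below z j) / expMean b z
        - fracBelow z)) / n := by
  have hP := expMean_pos b z
  have hn : (0 : ℝ) < n := Nat.cast_pos.2 (NeZero.pos n)
  have h1 : stepMean z (relChange b z) = mean (fun j => stepMean z fun k =>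
      Real.exp (b * z j) * (Real.exp (b * incr k j) - 1)) / expMean b z := by
    rw [← stepMean_mean, div_eq_inv_mul, ← stepMean_mul_left]
    congr 1; ext k; rw [relChange_eq, div_eq_inv_mul]
  -- The bound exp x ≤ 1 + x + x^2 separates the drift (`below` - d)/n from a second moment of at
  -- most 3/n.
  have h2 : ∀ j, (stepMean z fun k => Real.exp (b * z j) * (Real.exp (b * incr k j) - 1)) ≤
      1 / n * (b * (Real.exp (b * z j) * below z j)
        + (3 * b ^ 2 - b * fracBelow z) * Real.exp (b * z j)) := by
    intro j
    rw [stepMean_mul_left]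
    have h3 : stepMean z (fun k => Real.exp (b * incr k j) - 1) ≤
        stepMean z (fun k => b * incr k j + b ^ 2 * incr k j ^ 2) := by
      refine stepMean_mono z fun k => ?_
      have h2 : |b * incr k j| ≤ 1 := by
        rw [abs_mul]; exact mul_le_one₀ hb (abs_nonneg _) (abs_incr_le_one k j)
      have := exp_le_one_add_add_sq h2
      rw [mul_pow] at this; linarith
    rw [stepMean_add, stepMean_mul_left, stepMean_mul_left, stepMean_incr, weight_sub] at h3
    have h4 := mul_le_mul_of_nonneg_left (stepMean_incr_sq_le z j) (sq_nonneg b)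
    calc _ ≤ Real.exp (b * z j) * (b * ((below z j - fracBelow z) / n) + b ^ 2 * (3 / n)) := by
          gcongr; linarith
      _ = _ := by ring
  rw [h1, div_le_iff₀ hP]
  refine (mean_mono h2).trans (le_of_eq ?_)
  rw [mean_mul_left, mean_add, mean_mul_left, mean_mul_left]
  change 1 / (n : ℝ) * (b * _ + _ * expMean b z) = _
  field_simp
  ring

end OneStep

/-! ### Pull towards the threshold, and the Huber potential -/

section Drift

variable {n : ℕ}

/-- The average amount by which bins exceed the threshold. -/
noncomputable def surplus (z : Fin n → ℝ) : ℝ := mean fun i => max (z i) 0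

/-- The average amount by which bins fall short of the threshold. -/
noncomputable def deficit (z : Fin n → ℝ) : ℝ := mean fun i => max (-z i) 0

lemma surplus_nonneg (z : Fin n → ℝ) : 0 ≤ surplus z := mean_nonneg fun _ => le_max_right _ _

lemma deficit_nonneg (z : Fin n → ℝ) : 0 ≤ deficit z := mean_nonneg fun _ => le_max_right _ _

lemma surplus_sub_deficit (z : Fin n → ℝ) : surplus z - deficit z = mean z := by
  rw [surplus, deficit, ← mean_sub]
  congr 1; ext i
  rcases le_total (z i) 0 with h | h
  · rw [max_eq_right h, max_eq_left (by linarith)]; ring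
  · rw [max_eq_left h, max_eq_right (by linarith)]; ring

lemma surplus_add_deficit (z : Fin n → ℝ) : surplus z + deficit z = mean fun i => |z i| := by
  rw [surplus, deficit, ← mean_add]
  congr 1; ext i
  rcases le_total (z i) 0 with h | h
  · rw [max_eq_right h, max_eq_left (by linarith), abs_of_nonpos h]; ring
  · rw [max_eq_left h, max_eq_right (by linarith), abs_of_nonneg h]; ring

/-- The average of `exp (b * z i)` over all bins, with the bins above the threshold left out. -/
noncomputable def expMeanBelow (b : ℝ) (z : Fin n → ℝ) : ℝ :=
  mean fun j => Real.exp (b * z j) * below z j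

lemma expMeanBelow_le_fracBelow {g : ℝ} (hg : 0 ≤ g) (z : Fin n → ℝ) :
    expMeanBelow g z ≤ fracBelow z := by
  refine mean_mono fun j => ?_
  unfold below
  split_ifs with h
  · rw [mul_one]; exact Real.exp_le_one_iff.2 (mul_nonpos_of_nonneg_of_nonpos hg h.le)
  · simp

/-- The difference is carried by the bins with z ≥ 0, where exp(g z) ≥ 1 + g z. -/
lemma le_expMean_sub_expMeanBelow [NeZero n] {g : ℝ} (z : Fin n → ℝ) :
    (1 - fracBelow z) + g * surplus z ≤ expMean g z - expMeanBelow g z := by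
  rw [fracBelow, surplus, expMean, expMeanBelow, ← mean_mul_left, ← mean_sub,
    ← mean_const (n := n) 1, ← mean_sub, ← mean_add]
  refine mean_mono fun j => ?_
  have := Real.add_one_le_exp (g * z j)
  unfold below
  split_ifs with h
  · rw [max_eq_right h.le]; simp
  · rw [max_eq_left (not_lt.1 h)]; linarith

lemma le_expMeanBelow_neg {g : ℝ} (z : Fin n → ℝ) :
    fracBelow z + g * deficit z ≤ expMeanBelow (-g) z := by
  rw [fracBelow, deficit, expMeanBelow, ← mean_mul_left, ← mean_add]
  refine mean_mono fun j => ?_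
  have := Real.add_one_le_exp (-g * z j)
  unfold below
  split_ifs with h
  · rw [max_eq_left (by linarith)]; linarith
  · rw [max_eq_right (by linarith)]; simp

lemma expMean_neg_sub_expMeanBelow_le [NeZero n] {g : ℝ} (hg : 0 ≤ g) (z : Fin n → ℝ) :
    expMean (-g) z - expMeanBelow (-g) z ≤ 1 - fracBelow z := by
  rw [fracBelow, expMean, expMeanBelow, ← mean_sub, ← mean_const (n := n) 1, ← mean_sub]
  refine mean_mono fun j => ?_
  unfold below
  split_ifs with h
  · simp
  · have : Real.exp (-g * z j) ≤ 1 := Real.exp_le_one_iff.2 (by nlinarith)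
    simpa using this

/-- The drift towards the threshold of the bins above it. -/
noncomputable def overDrop (g : ℝ) (z : Fin n → ℝ) : ℝ :=
  fracBelow z * expMean g z - expMeanBelow g z

/-- The drift towards the threshold of the bins below it. -/
noncomputable def underDrop (g : ℝ) (z : Fin n → ℝ) : ℝ :=
  expMeanBelow (-g) z - fracBelow z * expMean (-g) z

lemma le_overDrop {g : ℝ} (hg : 0 ≤ g) (z : Fin n → ℝ) :
    fracBelow z * (expMean g z - 1) ≤ overDrop g z := by
  have := expMeanBelow_le_fracBelow hg z
  unfold overDrop; linarith

/-- With P and E for `expMean` and `expMeanBelow`, the drop is d (P - E) - (1 - d) E. The constant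
parts d (1 - d) of the bounds for the two terms cancel, which leaves the surplus. -/
lemma mul_surplus_le_overDrop [NeZero n] {g : ℝ} (hg : 0 ≤ g) (z : Fin n → ℝ) :
    fracBelow z * (g * surplus z) ≤ overDrop g z := by
  have h1 := expMeanBelow_le_fracBelow hg z
  have h2 := le_expMean_sub_expMeanBelow (g := g) z
  have h3 := mul_le_mul_of_nonneg_left h2 (fracBelow_nonneg z)
  have h4 := mul_le_mul_of_nonneg_left h1 (sub_nonneg.2 (fracBelow_le_one z))
  unfold overDrop; linarith

lemma overDrop_nonneg [NeZero n] {g : ℝ} (hg : 0 ≤ g) (z : Fin n → ℝ) : 0 ≤ overDrop g z :=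
  le_trans (mul_nonneg (fracBelow_nonneg z) (mul_nonneg hg (surplus_nonneg z)))
    (mul_surplus_le_overDrop hg z)

lemma le_underDrop [NeZero n] {g : ℝ} (hg : 0 ≤ g) (z : Fin n → ℝ) :
    (1 - fracBelow z) * (expMean (-g) z - 1) ≤ underDrop g z := by
  have := expMean_neg_sub_expMeanBelow_le hg z
  unfold underDrop; linarith

lemma mul_deficit_le_underDrop [NeZero n] {g : ℝ} (hg : 0 ≤ g) (z : Fin n → ℝ) :
    (1 - fracBelow z) * (g * deficit z) ≤ underDrop g z := by
  have h1 := expMean_neg_sub_expMeanBelow_le hg z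
  have h2 := le_expMeanBelow_neg (g := g) z
  have h3 := mul_le_mul_of_nonneg_left h1 (fracBelow_nonneg z)
  have h4 := mul_le_mul_of_nonneg_left h2 (sub_nonneg.2 (fracBelow_le_one z))
  unfold underDrop; linarith

lemma underDrop_nonneg [NeZero n] {g : ℝ} (hg : 0 ≤ g) (z : Fin n → ℝ) : 0 ≤ underDrop g z :=
  le_trans (mul_nonneg (sub_nonneg.2 (fracBelow_le_one z)) (mul_nonneg hg (deficit_nonneg z)))
    (mul_deficit_le_underDrop hg z)

lemma stepMean_relChange_pos_le [NeZero n] {g : ℝ} (hg : |g| ≤ 1) (z : Fin n → ℝ) :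
    stepMean z (relChange g z) ≤ (3 * g ^ 2 - g * (overDrop g z / expMean g z)) / n := by
  have hP := (expMean_pos g z).ne'
  refine (stepMean_relChange_le hg z).trans (le_of_eq ?_)
  rw [overDrop, expMeanBelow]
  field_simp
  ring

lemma stepMean_relChange_neg_le [NeZero n] {g : ℝ} (hg : |g| ≤ 1) (z : Fin n → ℝ) :
    stepMean z (relChange (-g) z) ≤
      (3 * g ^ 2 - g * (underDrop g z / expMean (-g) z)) / n := by
  have hP := (expMean_pos (-g) z).ne'
  refine (stepMean_relChange_le (b := -g) (by rwa [abs_neg]) z).trans (le_of_eq ?_)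
  rw [underDrop, expMeanBelow]
  field_simp
  ring

/-! ### The Huber potential -/

/-- The projection onto the interval `[-R, R]`. -/
noncomputable def clamp (R z : ℝ) : ℝ := max (-R) (min R z)

/-- The Huber function: `z ^ 2 / 2` on `[-R, R]`, extended linearly. -/
noncomputable def huber (R z : ℝ) : ℝ := clamp R z * z - clamp R z ^ 2 / 2

lemma abs_clamp_le {R : ℝ} (hR : 0 ≤ R) (z : ℝ) : |clamp R z| ≤ R := by
  rw [abs_le]
  exact ⟨le_max_left _ _, max_le (by linarith) (min_le_left _ _)⟩

lemma clamp_eq_self {R z : ℝ} (h : |z| ≤ R) : clamp R z = z := by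
  rw [abs_le] at h
  rw [clamp, min_eq_right h.2, max_eq_right h.1]

/-- The Huber function is the supremum of these affine functions over |c| ≤ R, attained at c =
`clamp R z`. Hence it is convex with subgradient `clamp R z`. -/
lemma le_huber {R c : ℝ} (hc : |c| ≤ R) (z : ℝ) : c * z - c ^ 2 / 2 ≤ huber R z := by
  rw [abs_le] at hc
  unfold huber clamp
  rcases le_total R z with h | h
  · rw [min_eq_left h, max_eq_right (by linarith)]; nlinarith
  · rw [min_eq_right h]
    rcases le_total z (-R) with h' | h'
    · rw [max_eq_left h']; nlinarith
    · rw [max_eq_right h']; nlinarith [sq_nonneg (z - c)]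

lemma huber_nonneg {R : ℝ} (hR : 0 ≤ R) (z : ℝ) : 0 ≤ huber R z := by
  simpa using le_huber (c := 0) (by simpa using hR) z

lemma huber_le {R : ℝ} (hR : 0 ≤ R) (z : ℝ) : huber R z ≤ R * |z| := by
  have h1 : clamp R z * z ≤ R * |z| := by
    refine (le_abs_self _).trans ?_
    rw [abs_mul]
    exact mul_le_mul_of_nonneg_right (abs_clamp_le hR z) (abs_nonneg _)
  unfold huber; nlinarith [sq_nonneg (clamp R z)]

lemma huber_add_ge {R : ℝ} (hR : 0 ≤ R) (z x : ℝ) :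
    huber R z + clamp R z * x ≤ huber R (z + x) := by
  have := le_huber (abs_clamp_le hR z) (z + x)
  unfold huber at this ⊢; linarith

/-- Inside the quadratic zone the expansion is exact; the term x^2/2 is the gain from variance. -/
lemma huber_add_of_abs_le {R z x : ℝ} (hz : |z| ≤ R - 1) (hx : |x| ≤ 1) :
    huber R (z + x) = huber R z + clamp R z * x + x ^ 2 / 2 := by
  have h : |z + x| ≤ R := (abs_add_le _ _).trans (by linarith)
  unfold huber
  rw [clamp_eq_self h, clamp_eq_self (by linarith)]; ring

lemma abs_huber_add_sub_le {R : ℝ} (hR : 0 ≤ R) (z x : ℝ) :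
    |huber R (z + x) - huber R z| ≤ R * |x| := by
  have h1 := huber_add_ge hR z x
  have h2 := huber_add_ge hR (z + x) (-x)
  rw [add_neg_cancel_right] at h2
  have h3 : ∀ w, |clamp R w * x| ≤ R * |x| := fun w => by
    rw [abs_mul]; exact mul_le_mul_of_nonneg_right (abs_clamp_le hR w) (abs_nonneg _)
  have h4 := abs_le.1 (h3 z)
  have h5 := abs_le.1 (h3 (z + x))
  rw [abs_le]; constructor <;> linarith

/-- The average of the Huber function over the bins. -/
noncomputable def huberMean (R : ℝ) (z : Fin n → ℝ) : ℝ := mean fun i => huber R (z i)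

lemma huberMean_nonneg {R : ℝ} (hR : 0 ≤ R) (z : Fin n → ℝ) : 0 ≤ huberMean R z :=
  mean_nonneg fun _ => huber_nonneg hR _

lemma huberMean_le {R : ℝ} (hR : 0 ≤ R) (z : Fin n → ℝ) :
    huberMean R z ≤ R * mean fun i => |z i| := by
  rw [← mean_mul_left]; exact mean_mono fun _ => huber_le hR _

lemma abs_huberMean_shift_sub_le [NeZero n] {R : ℝ} (hR : 0 ≤ R) (z : Fin n → ℝ) (k : Fin n) :
    |huberMean R (shift z k) - huberMean R z| ≤ 2 * R / n := by
  have hn : (0 : ℝ) < n := Nat.cast_pos.2 (NeZero.pos n)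
  rw [huberMean, huberMean, ← mean_sub, mean, abs_div, abs_of_pos hn]
  gcongr
  refine (Finset.abs_sum_le_sum_abs _ _).trans ?_
  calc _ ≤ ∑ j, R * ((if j = k then 1 else 0) + 1 / (n : ℝ)) :=
        Finset.sum_le_sum fun j _ => (abs_huber_add_sub_le hR (z j) (incr k j)).trans
          (mul_le_mul_of_nonneg_left (abs_incr_le k j) hR)
    _ = 2 * R := by
        rw [← Finset.mul_sum, Finset.sum_add_distrib]
        simp [hn.ne']; ring

/-- The mass of bins within distance `R - 1` of the threshold, each weighted by `n` times its
probability of receiving the next ball. -/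
noncomputable def nearMass (R : ℝ) (z : Fin n → ℝ) : ℝ :=
  mean fun j => (if |z j| ≤ R - 1 then 1 else 0) * (below z j + (1 - fracBelow z))

lemma nearMass_nonneg [NeZero n] (R : ℝ) (z : Fin n → ℝ) : 0 ≤ nearMass R z :=
  mean_nonneg fun j => mul_nonneg (by split_ifs <;> norm_num)
    (add_nonneg (below_nonneg z j) (sub_nonneg.2 (fracBelow_le_one z)))

/-- The Huber potential increases in expectation when most bins lie on one side of the threshold
and the near mass is large. -/
lemma le_stepMean_huberMean [NeZero n] (hn : 2 ≤ n) {R : ℝ} (hR : 0 ≤ R) (z : Fin n → ℝ) :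
    (nearMass R z / 8 - 2 * R * (1 - fracBelow z) * fracBelow z) / n ≤
      stepMean z fun k => huberMean R (shift z k) - huberMean R z := by
  have hn0 : (0 : ℝ) < n := Nat.cast_pos.2 (NeZero.pos n)
  set d := fracBelow z with hd
  have hd0 : 0 ≤ d := fracBelow_nonneg z
  have hd1 : d ≤ 1 := fracBelow_le_one z
  have h1 : (stepMean z fun k => huberMean R (shift z k) - huberMean R z) =
      mean fun j => stepMean z fun k => huber R (z j + incr k j) - huber R (z j) := by
    rw [← stepMean_mean]
    congr 1; ext k; rw [huberMean, huberMean, ← mean_sub]; rfl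
  have h2 : ∀ j, 1 / n * (1 / 8 * ((if |z j| ≤ R - 1 then 1 else 0) * (below z j + (1 - d)))
      - R * ((1 - d) * below z j + d * (1 - below z j))) ≤
      stepMean z fun k => huber R (z j + incr k j) - huber R (z j) := by
    intro j
    have h3 : stepMean z (fun k => clamp R (z j) * incr k j
        + (if |z j| ≤ R - 1 then 1 else 0) / 2 * incr k j ^ 2) ≤
        stepMean z fun k => huber R (z j + incr k j) - huber R (z j) := by
      refine stepMean_mono z fun k => ?_
      split_ifs with h
      · rw [huber_add_of_abs_le h (abs_incr_le_one k j)]; linarith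
      · have := huber_add_ge hR (z j) (incr k j); linarith
    refine le_trans ?_ h3
    rw [stepMean_add, stepMean_mul_left, stepMean_mul_left, stepMean_incr, weight_sub]
    have h4 := le_stepMean_incr_sq hn z j
    have h5 : (if |z j| ≤ R - 1 then (1 : ℝ) else 0) / 2 * (weight z j / 4) ≤
        (if |z j| ≤ R - 1 then (1 : ℝ) else 0) / 2 * stepMean z (fun k => incr k j ^ 2) :=
      mul_le_mul_of_nonneg_left h4 (by split_ifs <;> norm_num)
    -- The bracket is |`below` - d|, with average 2 d (1 - d): the drift hardly lowers the Huber
    -- potential when d is near 0 or 1.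
    have h6 : -(R * ((1 - d) * below z j + d * (1 - below z j))) ≤
        clamp R (z j) * (below z j - d) := by
      have hc := abs_le.1 (abs_clamp_le hR (z j))
      unfold below
      split_ifs <;> nlinarith
    have h7 := div_le_div_of_nonneg_right h6 hn0.le
    calc _ = -(R * ((1 - d) * below z j + d * (1 - below z j))) / n
          + (if |z j| ≤ R - 1 then (1 : ℝ) else 0) / 2 * (weight z j / 4) := by
          rw [weight]; ring
      _ ≤ _ := by rw [mul_div_assoc (clamp R (z j))] at h7; linarith
  rw [h1]
  refine le_trans (le_of_eq ?_) (mean_mono h2)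
  rw [mean_mul_left, mean_sub, mean_mul_left, mean_mul_left, mean_add, mean_mul_left,
    mean_mul_left, mean_sub, mean_const]
  change _ = 1 / (n : ℝ) * (1 / 8 * nearMass R z - R * ((1 - d) * d + d * (1 - d)))
  ring

/-- Markov's inequality for |z|. -/
lemma le_nearMass_aux [NeZero n] {R : ℝ} (hR : 1 < R) (z : Fin n → ℝ)
    (hz : 4 * (mean fun i => |z i|) ≤ R - 1) :
    mean (fun j => 1 - (if |z j| ≤ R - 1 then (1 : ℝ) else 0)) ≤ 1 / 4 := by
  have h : ∀ j, 1 - (if |z j| ≤ R - 1 then (1 : ℝ) else 0) ≤ (R - 1)⁻¹ * |z j| := by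
    intro j
    have : 0 < R - 1 := by linarith
    split_ifs with h
    · simpa using mul_nonneg (inv_nonneg.2 this.le) (abs_nonneg _)
    · rw [inv_mul_eq_div, le_div_iff₀ this]; linarith
  refine (mean_mono h).trans ?_
  rw [mean_mul_left, inv_mul_eq_div, div_le_iff₀ (by linarith)]; linarith

/-- If the bins are close to the threshold on average, then the near mass is large. -/
lemma one_div_eight_le_nearMass [NeZero n] {R : ℝ} (hR : 1 < R) (z : Fin n → ℝ)
    (hz : 4 * (mean fun i => |z i|) ≤ R - 1) : 1 / 8 ≤ nearMass R z := by
  have h1 := le_nearMass_aux hR z hz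
  set d := fracBelow z with hd
  have hd0 : 0 ≤ d := fracBelow_nonneg z
  have hd1 : d ≤ 1 := fracBelow_le_one z
  -- The factor `below` + 1 - d has average 1 and is at most 2 - d, so discarding a quarter of the
  -- bins costs at most half of the mass.
  have h2 : ∀ j, (below z j + (1 - d)) - (2 - d) * (1 - (if |z j| ≤ R - 1 then (1 : ℝ) else 0)) ≤
      (if |z j| ≤ R - 1 then 1 else 0) * (below z j + (1 - d)) := by
    intro j
    have := below_nonneg z j
    have := below_le_one z j
    split_ifs <;> nlinarith
  have h3 := mean_mono h2
  rw [mean_sub, mean_mul_left, mean_add, mean_const] at h3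
  change d + (1 - d) - _ ≤ nearMass R z at h3
  nlinarith

end Drift

/-! ### The damped two-sided potential and its first-order drift -/

section Potential

variable {n : ℕ}

/-- The two-sided exponential potential, damped by the Huber potential. -/
noncomputable def potential (g R : ℝ) (z : Fin n → ℝ) : ℝ :=
  expMean g z * expMean (-g) z * Real.exp (-(50000 * g ^ 2 * huberMean R z))

/-- A first-order bound for the change of the logarithm of `potential`. -/
noncomputable def totalChange (g R : ℝ) (z : Fin n → ℝ) (k : Fin n) : ℝ :=
  relChange g z k + relChange (-g) z k
    - 50000 * g ^ 2 * (huberMean R (shift z k) - huberMean R z)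

lemma potential_pos [NeZero n] (g R : ℝ) (z : Fin n → ℝ) : 0 < potential g R z :=
  mul_pos (mul_pos (expMean_pos _ _) (expMean_pos _ _)) (Real.exp_pos _)

lemma potential_le [NeZero n] (g : ℝ) {R : ℝ} (hR : 0 ≤ R) (z : Fin n → ℝ) :
    potential g R z ≤ expMean g z * expMean (-g) z := by
  refine mul_le_of_le_one_right (mul_pos (expMean_pos _ _) (expMean_pos _ _)).le ?_
  rw [Real.exp_le_one_iff, neg_nonpos]
  have := huberMean_nonneg hR z
  positivity

lemma expMean_shift_le [NeZero n] (b : ℝ) (z : Fin n → ℝ) (k : Fin n) :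
    expMean b (shift z k) ≤ expMean b z * Real.exp (relChange b z k) := by
  rw [expMean_shift]
  have := Real.add_one_le_exp (relChange b z k)
  exact mul_le_mul_of_nonneg_left (by linarith) (expMean_pos b z).le

/-- For the two exponential averages this is 1 + x ≤ exp x; the Huber factor changes by exactly the
stated exponent. -/
lemma potential_shift_le [NeZero n] (g R : ℝ) (z : Fin n → ℝ) (k : Fin n) :
    potential g R (shift z k) ≤ potential g R z * Real.exp (totalChange g R z k) := by
  have h1 := expMean_shift_le g z k
  have h2 := expMean_shift_le (-g) z k
  have h3 : Real.exp (-(50000 * g ^ 2 * huberMean R (shift z k))) =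
      Real.exp (-(50000 * g ^ 2 * huberMean R z)) *
        Real.exp (-(50000 * g ^ 2 * (huberMean R (shift z k) - huberMean R z))) := by
    rw [← Real.exp_add]; ring_nf
  have h4 : Real.exp (totalChange g R z k) =
      Real.exp (relChange g z k) * Real.exp (relChange (-g) z k) *
        Real.exp (-(50000 * g ^ 2 * (huberMean R (shift z k) - huberMean R z))) := by
    rw [← Real.exp_add, ← Real.exp_add]; rfl
  unfold potential
  rw [h3, h4]
  have h5 := mul_le_mul h1 h2 (expMean_pos _ _).le
    (mul_pos (expMean_pos g z) (Real.exp_pos _)).le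
  have h6 := mul_le_mul_of_nonneg_right h5 (mul_pos
    (Real.exp_pos (-(50000 * g ^ 2 * huberMean R z)))
    (Real.exp_pos (-(50000 * g ^ 2 * (huberMean R (shift z k) - huberMean R z))))).le
  exact h6.trans (le_of_eq (by ring))

/-- The share of bin `k` in the exponential potential. -/
noncomputable def share (b : ℝ) (z : Fin n → ℝ) (k : Fin n) : ℝ :=
  Real.exp (b * z k) / (n * expMean b z)

lemma share_nonneg [NeZero n] (b : ℝ) (z : Fin n → ℝ) (k : Fin n) : 0 ≤ share b z k :=
  div_nonneg (Real.exp_pos _).le (mul_nonneg (Nat.cast_nonneg n) (expMean_pos b z).le)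

lemma share_le_one [NeZero n] (b : ℝ) (z : Fin n → ℝ) (k : Fin n) : share b z k ≤ 1 :=
  div_le_one_of_le₀ (exp_le_expMean b z k)
    (mul_nonneg (Nat.cast_nonneg n) (expMean_pos b z).le)

lemma mean_share [NeZero n] (b : ℝ) (z : Fin n → ℝ) : mean (share b z) = 1 / n := by
  have h := (expMean_pos b z).ne'
  have hn : (n : ℝ) ≠ 0 := Nat.cast_ne_zero.2 (NeZero.ne n)
  have : mean (share b z) = mean (fun k => (n * expMean b z)⁻¹ * Real.exp (b * z k)) := by
    congr 1; ext k; rw [share, div_eq_inv_mul]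
  rw [this, mean_mul_left]
  change _ * expMean b z = _
  field_simp

lemma stepMean_share_le [NeZero n] (b : ℝ) (z : Fin n → ℝ) : stepMean z (share b z) ≤ 2 / n := by
  refine (stepMean_le z (share_nonneg b z)).trans (le_of_eq ?_)
  rw [mean_share]; ring

lemma abs_relChange_le_share [NeZero n] {b : ℝ} (hb : |b| ≤ 1) (z : Fin n → ℝ) (k : Fin n) :
    |relChange b z k| ≤ 2 * |b| * (share b z k + 1 / n) := abs_relChange_le hb z k

/-- Each exponential average contributes 2 g (share + 1/n). The linear tails of the Huber function
and the smallness of g R keep the damping term below g/n. -/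
lemma abs_totalChange_le [NeZero n] {g R : ℝ} (hg : 0 < g) (hg1 : g ≤ 1) (hR : 0 ≤ R)
    (hgR : 1600000 * (g * R) ≤ 1) (z : Fin n → ℝ) (k : Fin n) :
    |totalChange g R z k| ≤ g * (2 * share g z k + 2 * share (-g) z k + 5 * (1 / n)) := by
  have hn : (0 : ℝ) < n := Nat.cast_pos.2 (NeZero.pos n)
  have hb : |g| ≤ 1 := by rwa [abs_of_pos hg]
  have h1 := abs_relChange_le_share hb z k
  have h2 := abs_relChange_le_share (b := -g) (by rwa [abs_neg]) z k
  have h3 := abs_huberMean_shift_sub_le hR z k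
  rw [abs_of_pos hg] at h1
  rw [abs_neg, abs_of_pos hg] at h2
  have h4 : |50000 * g ^ 2 * (huberMean R (shift z k) - huberMean R z)| ≤ g * (1 / n) := by
    rw [abs_mul, abs_of_pos (by positivity)]
    calc _ ≤ 50000 * g ^ 2 * (2 * R / n) := by gcongr
      _ = g * (100000 * (g * R)) * (1 / n) := by ring
      _ ≤ g * 1 * (1 / n) := by gcongr; linarith
      _ = _ := by ring
  unfold totalChange
  calc _ ≤ |relChange g z k| + |relChange (-g) z k| +
        |50000 * g ^ 2 * (huberMean R (shift z k) - huberMean R z)| :=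
        (abs_sub _ _).trans (add_le_add_left (abs_add_le _ _) _)
    _ ≤ _ := by linarith

lemma stepMean_abs_totalChange_le [NeZero n] {g R : ℝ} (hg : 0 < g) (hg1 : g ≤ 1) (hR : 0 ≤ R)
    (hgR : 1600000 * (g * R) ≤ 1) (z : Fin n → ℝ) :
    stepMean z (fun k => |totalChange g R z k|) ≤ 13 * g / n := by
  refine (stepMean_mono z (abs_totalChange_le hg hg1 hR hgR z)).trans ?_
  rw [stepMean_mul_left, stepMean_add, stepMean_add, stepMean_mul_left, stepMean_mul_left,
    stepMean_const]
  have h1 := stepMean_share_le g z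
  have h2 := stepMean_share_le (-g) z
  calc g * (2 * stepMean z (share g z) + 2 * stepMean z (share (-g) z) + 5 * (1 / n))
      ≤ g * (2 * (2 / n) + 2 * (2 / n) + 5 * (1 / n)) := by gcongr
    _ = _ := by ring

/-- No bin dominates the potential to the `th`-th power. -/
def Balanced (th g : ℝ) (z : Fin n → ℝ) : Prop :=
  th ≤ n ∧ ∀ k, th * share g z k ≤ 1 ∧ th * share (-g) z k ≤ 1

lemma balanced_one [NeZero n] (g : ℝ) (z : Fin n → ℝ) : Balanced 1 g z :=
  ⟨by exact_mod_cast NeZero.one_le, fun k => by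
    rw [one_mul, one_mul]; exact ⟨share_le_one _ _ _, share_le_one _ _ _⟩⟩

lemma mul_abs_totalChange_le [NeZero n] {g R th : ℝ} (hg : 0 < g) (hg1 : g ≤ 1) (hR : 0 ≤ R)
    (hgR : 1600000 * (g * R) ≤ 1) (hth : 0 ≤ th) {z : Fin n → ℝ} (hz : Balanced th g z)
    (k : Fin n) : th * |totalChange g R z k| ≤ 9 * g := by
  have hn : (0 : ℝ) < n := Nat.cast_pos.2 (NeZero.pos n)
  have h0 : th * (1 / n) ≤ 1 := by
    rw [mul_one_div, div_le_one hn]; exact hz.1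
  obtain ⟨h1, h2⟩ := hz.2 k
  have h := mul_le_mul_of_nonneg_left (abs_totalChange_le hg hg1 hR hgR z k) hth
  nlinarith

/-- 117 = 9 * 13: one factor is bounded pointwise by `mul_abs_totalChange_le`, the other on average
by `stepMean_abs_totalChange_le`. -/
lemma mul_stepMean_totalChange_sq_le [NeZero n] {g R th : ℝ} (hg : 0 < g) (hg1 : g ≤ 1)
    (hR : 0 ≤ R) (hgR : 1600000 * (g * R) ≤ 1) (hth : 0 ≤ th) {z : Fin n → ℝ}
    (hz : Balanced th g z) :
    th * stepMean z (fun k => totalChange g R z k ^ 2) ≤ 117 * g ^ 2 / n := by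
  rw [← stepMean_mul_left]
  have h : ∀ k, th * totalChange g R z k ^ 2 ≤ 9 * g * |totalChange g R z k| := by
    intro k
    have := mul_le_mul_of_nonneg_right (mul_abs_totalChange_le hg hg1 hR hgR hth hz k)
      (abs_nonneg (totalChange g R z k))
    rw [← sq_abs]; linarith
  refine (stepMean_mono z h).trans ?_
  rw [stepMean_mul_left]
  calc _ ≤ 9 * g * (13 * g / n) := by
        gcongr; exact stepMean_abs_totalChange_le hg hg1 hR hgR z
    _ = _ := by ring

/-- The first-order drift of the logarithm of the potential. -/
lemma stepMean_totalChange_le [NeZero n] (hn : 2 ≤ n) {g R : ℝ} (hg : 0 < g) (hg1 : g ≤ 1)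
    (hR : 0 ≤ R) (z : Fin n → ℝ) :
    stepMean z (totalChange g R z) ≤
      (6 * g ^ 2 - g * (overDrop g z / expMean g z) - g * (underDrop g z / expMean (-g) z)
        + 50000 * g ^ 2 * (2 * R * (1 - fracBelow z) * fracBelow z - nearMass R z / 8)) / n := by
  have hb : |g| ≤ 1 := by rwa [abs_of_pos hg]
  have h1 := stepMean_relChange_pos_le hb z
  have h2 := stepMean_relChange_neg_le hb z
  have h3 := mul_le_mul_of_nonneg_left (le_stepMean_huberMean hn hR z)
    (show 0 ≤ 50000 * g ^ 2 by positivity)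
  unfold totalChange
  rw [stepMean_sub, stepMean_add, stepMean_mul_left]
  calc _ ≤ (3 * g ^ 2 - g * (overDrop g z / expMean g z)) / n
        + (3 * g ^ 2 - g * (underDrop g z / expMean (-g) z)) / n
        - 50000 * g ^ 2 * ((nearMass R z / 8 - 2 * R * (1 - fracBelow z) * fracBelow z) / n) := by
        linarith
    _ = _ := by ring

/-- The case analysis behind the negative drift of a large potential. -/
lemma drop_lower_bound {g d U V Z N B a K p q : ℝ} (hg : 0 < g) (hg' : 100000 * g ≤ 1)
    (hd0 : 0 ≤ d) (hd1 : d ≤ 1) (hU : 0 ≤ U) (hV : 0 ≤ V)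
    (hZN : Z - N = -a) (ha : 0 ≤ a) (hK : 16 * K ≤ 1) (hpq : 2 ≤ p ∨ 2 ≤ q) (hB0 : 0 ≤ B)
    (hp2 : 2 ≤ p → d / 2 ≤ U) (hp2' : p ≤ 2 → d * (g * Z) / 2 ≤ U)
    (hq2 : 2 ≤ q → (1 - d) / 2 ≤ V) (hq2' : q ≤ 2 → (1 - d) * (g * N) / 2 ≤ V)
    (hB : Z + N ≤ 8000 * (a + 1) → 1 / 8 ≤ B) :
    623 * g ≤ U + V - K * ((1 - d) * d) + 6250 * g * B := by
  have hKd : K * ((1 - d) * d) ≤ 1 / 16 * ((1 - d) * d) :=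
    mul_le_mul_of_nonneg_right (by linarith) (mul_nonneg (by linarith) hd0)
  have hgB : 0 ≤ g * B := mul_nonneg hg.le hB0
  -- If p ≥ 2, the pull d/2 suffices unless d < 2000 g. For such d the factor 1 - d is near 1, so V
  -- suffices if q ≥ 2 or N ≥ 4000. Otherwise Z + N = 2 N - a is small and the variance term 6250
  -- g/8 exceeds 623 g plus the loss of at most 125 g. The case q ≥ 2 is the mirror image.
  rcases le_or_gt 2 p with hp | hp
  · have hU' := hp2 hp
    rcases le_total (2000 * g) d with hd | hd
    · nlinarith
    · rcases le_total 2 q with hq | hq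
      · have hV' := hq2 hq
        nlinarith
      · have hV' := hq2' hq
        rcases le_total 4000 N with hN' | hN'
        · have : 4000 * g ≤ g * N := by nlinarith
          nlinarith
        · have := hB (by linarith)
          nlinarith
  · have hq : 2 ≤ q := hpq.resolve_left (not_le.2 hp)
    have hV' := hq2 hq
    have hU' := hp2' hp.le
    rcases le_total (2000 * g) (1 - d) with hd | hd
    · nlinarith
    · rcases le_total 4000 Z with hZ' | hZ'
      · have : 4000 * g ≤ g * Z := by nlinarith
        nlinarith
      · have := hB (by linarith)
        nlinarith

end Potential

/-! ### Recursion for powers of the potential -/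

section Recursion

variable {n : ℕ}

/-- A large potential has negative drift. -/
lemma stepMean_totalChange_le_of_le [NeZero n] (hn : 2 ≤ n) {g R a : ℝ} (hg : 0 < g) (ha : 0 ≤ a)
    (hR : 32000 * (a + 1) + 1 ≤ R) (hgR : 1600000 * (g * R) ≤ 1) {z : Fin n → ℝ}
    (hz : mean z = -a) (hW : 4 ≤ potential g R z) :
    stepMean z (totalChange g R z) ≤ -(617 * g ^ 2) / n := by
  have hn0 : (0 : ℝ) < n := Nat.cast_pos.2 (NeZero.pos n)
  have hg' : 100000 * g ≤ 1 := by nlinarith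
  have hR0 : 0 ≤ R := by linarith
  refine (stepMean_totalChange_le hn hg (by linarith) hR0 z).trans ?_
  refine div_le_div_of_nonneg_right ?_ hn0.le
  have hp := expMean_pos g z
  have hq := expMean_pos (-g) z
  have hpq : 4 ≤ expMean g z * expMean (-g) z := hW.trans (potential_le g hR0 z)
  have hd0 := fracBelow_nonneg z
  have hd1 := fracBelow_le_one z
  have hZ := surplus_nonneg z
  have hN := deficit_nonneg z
  have h := drop_lower_bound (d := fracBelow z) (U := overDrop g z / expMean g z)
    (V := underDrop g z / expMean (-g) z) (Z := surplus z) (N := deficit z) (B := nearMass R z)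
    (a := a) (K := 100000 * (g * R)) (p := expMean g z) (q := expMean (-g) z) hg hg' hd0 hd1
    (div_nonneg (overDrop_nonneg hg.le z) hp.le) (div_nonneg (underDrop_nonneg hg.le z) hq.le)
    (by rw [surplus_sub_deficit, hz]) ha (by linarith)
    (by by_contra! h; nlinarith) (nearMass_nonneg R z)
    (fun h => by
      rw [le_div_iff₀ hp]; have := le_overDrop hg.le z; nlinarith)
    (fun h => by
      rw [le_div_iff₀ hp]; have := mul_surplus_le_overDrop hg.le z
      have h0 : 0 ≤ fracBelow z * (g * surplus z) := by positivity
      nlinarith)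
    (fun h => by
      rw [le_div_iff₀ hq]; have := le_underDrop hg.le z; nlinarith)
    (fun h => by
      rw [le_div_iff₀ hq]; have := mul_deficit_le_underDrop hg.le z
      have h0 : 0 ≤ (1 - fracBelow z) * (g * deficit z) :=
        mul_nonneg (by linarith) (by positivity)
      nlinarith)
    (fun h => one_div_eight_le_nearMass (by linarith) z (by
      rw [← surplus_add_deficit]; linarith))
  -- 617 = 623 - 6, the 6 g^2 being the second-order cost of the two exponential averages.
  have := mul_le_mul_of_nonneg_left h hg.le
  nlinarith

/-- The function of the potential that satisfies the recursion: it vanishes for a potential of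
at most `4` and grows like the `2 * th`-th power. -/
noncomputable def excess (th : ℕ) (g R : ℝ) (z : Fin n → ℝ) : ℝ :=
  max ((potential g R z / 4) ^ th - 1) 0 ^ 2

lemma excess_nonneg (th : ℕ) (g R : ℝ) (z : Fin n → ℝ) : 0 ≤ excess th g R z := sq_nonneg _

lemma exp_sub_one_sq_le {x : ℝ} (hx : |x| ≤ 1) : (Real.exp x - 1) ^ 2 ≤ 4 * x ^ 2 := by
  have h := abs_exp_sub_one_le hx
  have := mul_self_le_mul_self (abs_nonneg _) h
  rw [← sq, sq_abs] at this
  calc _ ≤ _ := this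
    _ = 4 * |x| ^ 2 := by ring
    _ = _ := by rw [sq_abs]

/-- The one-step recursion for the excess potential. -/
lemma stepMean_excess_le [NeZero n] (hn : 2 ≤ n) {g R a : ℝ} (hg : 0 < g) (ha : 0 ≤ a)
    (hR : 32000 * (a + 1) + 1 ≤ R) (hgR : 1600000 * (g * R) ≤ 1) {z : Fin n → ℝ}
    (hz : mean z = -a) {th : ℕ} (hth0 : th ≠ 0) (hb : Balanced th g z) :
    stepMean z (fun k => excess th g R (shift z k)) ≤
      (1 - th * g ^ 2 / n) * excess th g R z + th * g ^ 2 / n * 500 := by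
  have hn0 : (0 : ℝ) < n := Nat.cast_pos.2 (NeZero.pos n)
  have hg' : 100000 * g ≤ 1 := by nlinarith
  have hR0 : 0 ≤ R := by linarith
  have hth : (0 : ℝ) ≤ th := Nat.cast_nonneg th
  set w := (potential g R z / 4) ^ th with hw
  have hw0 : 0 < w := pow_pos (div_pos (potential_pos g R z) (by norm_num)) th
  set X : Fin n → ℝ := fun k => Real.exp (th * totalChange g R z k) with hX
  have hX0 : ∀ k, 0 < X k := fun k => Real.exp_pos _
  have hstep : ∀ k, (potential g R (shift z k) / 4) ^ th ≤ w * X k := by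
    intro k
    rw [hX, hw]
    simp only
    rw [Real.exp_nat_mul, ← mul_pow]
    refine pow_le_pow_left₀ (div_pos (potential_pos g R _) (by norm_num)).le ?_ th
    have := potential_shift_le g R z k
    linarith
  have habs : ∀ k, |th * totalChange g R z k| ≤ 1 := by
    intro k
    rw [abs_mul, abs_of_nonneg hth]
    exact (mul_abs_totalChange_le hg (by linarith) hR0 hgR hth hb k).trans (by linarith)
  set e : ℝ := th * g ^ 2 / n with he
  have he0 : 0 ≤ e := by positivity
  have hsq : stepMean z (fun k => (th * totalChange g R z k) ^ 2) ≤ 117 * e := by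
    have h1 := mul_le_mul_of_nonneg_left
      (mul_stepMean_totalChange_sq_le hg (by linarith) hR0 hgR hth hb) hth
    simp_rw [mul_pow]
    rw [stepMean_mul_left]
    calc _ = th * (th * stepMean z (fun k => totalChange g R z k ^ 2)) := by ring
      _ ≤ _ := h1
      _ = _ := by rw [he]; ring
  have hX2 : stepMean z (fun k => (X k - 1) ^ 2) ≤ 468 * e := by
    refine (stepMean_mono z fun k => exp_sub_one_sq_le (habs k)).trans ?_
    rw [stepMean_mul_left]; linarith
  -- For w < 1 no drift is available, but the square of the positive part vanishes to second order
  -- at level 1, so only (X k - 1)^2 is gained. For w ≥ 1 the negative drift applies.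
  rcases lt_or_ge w 1 with hw1 | hw1
  · have h1 : excess th g R z = 0 := by
      rw [excess, max_eq_right (by linarith)]; norm_num
    have h2 : ∀ k, excess th g R (shift z k) ≤ (X k - 1) ^ 2 := by
      intro k
      rw [excess]
      rcases le_total ((potential g R (shift z k) / 4) ^ th - 1) 0 with h | h
      · rw [max_eq_right h]; simpa using sq_nonneg _
      · rw [max_eq_left h]
        refine pow_le_pow_left₀ h ?_ 2
        have := hstep k
        nlinarith [hX0 k]
    refine (stepMean_mono z h2).trans (hX2.trans ?_)
    rw [h1]; linarith
  · have hW : 4 ≤ potential g R z := by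
      by_contra! h
      have : w < 1 := pow_lt_one₀ (div_pos (potential_pos g R z) (by norm_num)).le
        (by linarith) hth0
      linarith
    have h1 : excess th g R z = (w - 1) ^ 2 := by
      rw [excess, max_eq_left (by linarith)]
    have h2 : ∀ k, excess th g R (shift z k) ≤
        (w - 1) ^ 2 + 2 * (w - 1) * w * (X k - 1) + w ^ 2 * (X k - 1) ^ 2 := by
      intro k
      have : (w - 1) ^ 2 + 2 * (w - 1) * w * (X k - 1) + w ^ 2 * (X k - 1) ^ 2 =
        (w * X k - 1) ^ 2 := by ring
      rw [this, excess]
      rcases le_total ((potential g R (shift z k) / 4) ^ th - 1) 0 with h | h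
      · rw [max_eq_right h]; simpa using sq_nonneg _
      · rw [max_eq_left h]
        exact pow_le_pow_left₀ h (by linarith [hstep k]) 2
    have hX1 : stepMean z (fun k => X k - 1) ≤ -(500 * e) := by
      have h3 : ∀ k, X k - 1 ≤ th * totalChange g R z k + (th * totalChange g R z k) ^ 2 :=
        fun k => by have := exp_le_one_add_add_sq (habs k); linarith
      refine (stepMean_mono z h3).trans ?_
      rw [stepMean_add, stepMean_mul_left]
      have h4 := mul_le_mul_of_nonneg_left
        (stepMean_totalChange_le_of_le hn hg ha hR hgR hz hW) hth
      have h5 : th * (-(617 * g ^ 2) / n) = -(617 * e) := by rw [he]; ring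
      change th * stepMean z (totalChange g R z) + _ ≤ _
      linarith
    refine (stepMean_mono z h2).trans ?_
    rw [stepMean_add, stepMean_add, stepMean_const, stepMean_mul_left, stepMean_mul_left, h1]
    have h6 := mul_le_mul_of_nonneg_left hX1 (show 0 ≤ 2 * (w - 1) * w by nlinarith)
    have h7 := mul_le_mul_of_nonneg_left hX2 (sq_nonneg w)
    -- What remains after comparing 2 * 500 (w - 1) w with 468 w^2 + (w - 1)^2 - 500; here 531 =
    -- 1000 - 468 - 1.
    have h8 : 0 ≤ e * (531 * w ^ 2 - 998 * w + 499) := by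
      refine mul_nonneg he0 ?_
      nlinarith [sq_nonneg (w - 1)]
    nlinarith

end Recursion

/-! ### What a bounded potential implies, and one-sided recursions -/

section Bounds

variable {n : ℕ}

/-- Jensen's inequality gives at least exp(-g a) ≥ 1 - g a. -/
lemma one_half_le_expMean [NeZero n] {g a : ℝ} (hga : g * a ≤ 1 / 2) {z : Fin n → ℝ}
    (hz : mean z = -a) : 1 / 2 ≤ expMean g z := by
  have h1 := exp_mean_le_expMean g z
  have h2 := Real.add_one_le_exp (g * mean z)
  rw [hz] at h1 h2
  linarith

lemma one_le_expMean_neg [NeZero n] {g a : ℝ} (hg : 0 ≤ g) (ha : 0 ≤ a) {z : Fin n → ℝ}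
    (hz : mean z = -a) : 1 ≤ expMean (-g) z := by
  have h1 := exp_mean_le_expMean (-g) z
  rw [hz] at h1
  refine (Real.one_le_exp ?_).trans h1
  nlinarith

/-- The potential controls both exponential averages. -/
lemma expMean_add_expMean_neg_le [NeZero n] {g R a : ℝ} (hg : 0 < g) (ha : 0 ≤ a)
    (hga : g * a ≤ 1 / 2) (hR : 0 ≤ R) (hgR : 1600000 * (g * R) ≤ 1) {z : Fin n → ℝ}
    (hz : mean z = -a) :
    expMean g z + expMean (-g) z ≤ 16 * potential g R z ^ 2 := by
  have hp := one_half_le_expMean hga hz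
  have hq := one_le_expMean_neg hg.le ha hz
  set p := expMean g z
  set q := expMean (-g) z
  set M := mean fun i => |z i| with hM
  have h1 : Real.exp (g * M) ≤ p + q := by
    refine (exp_mean_le_expMean g fun i => |z i|).trans ?_
    change _ ≤ mean _ + mean _
    rw [← mean_add]
    refine mean_mono fun i => ?_
    rcases le_total 0 (z i) with h | h
    · simp only [abs_of_nonneg h]; linarith [Real.exp_pos (-g * z i)]
    · simp only [abs_of_nonpos h, mul_neg, neg_mul]; linarith [Real.exp_pos (g * z i)]
  have hM0 : 0 ≤ M := mean_nonneg fun i => abs_nonneg _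
  -- As g R is tiny, the damping factor is at least exp(-g M/2), and exp(g M) ≤ p + q by `h1`.
  -- Damping therefore loses at most a factor √(p + q).
  have h2 : Real.exp (-(g * M / 2)) ≤ Real.exp (-(50000 * g ^ 2 * huberMean R z)) := by
    rw [Real.exp_le_exp, neg_le_neg_iff]
    calc _ ≤ 50000 * g ^ 2 * (R * M) := by gcongr; exact huberMean_le hR z
      _ = 50000 * (g * R) * (g * M) := by ring
      _ ≤ 1 / 2 * (g * M) := by
        have : 0 ≤ g * M := by positivity
        gcongr; linarith
      _ = _ := by ring
  have h3 : (p + q) / 4 ≤ p * q := by nlinarith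
  have h4 : (p + q) / 4 * Real.exp (-(g * M / 2)) ≤ potential g R z :=
    mul_le_mul h3 h2 (Real.exp_pos _).le (by positivity)
  have h5 : ((p + q) / 4) ^ 2 * Real.exp (-(g * M)) ≤ potential g R z ^ 2 := by
    have h6 := pow_le_pow_left₀ (by positivity) h4 2
    have h8 : Real.exp (-(g * M)) = Real.exp (-(g * M / 2)) ^ 2 := by
      rw [← Real.exp_nat_mul]; congr 1; push_cast; ring
    rw [mul_pow] at h6
    rwa [h8]
  have h7 : 1 ≤ (p + q) * Real.exp (-(g * M)) := by
    rw [Real.exp_neg, ← div_eq_mul_inv, le_div_iff₀ (Real.exp_pos _)]; linarith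
  nlinarith

/-- With y the positive part of potential/4 - 1, this is y ≤ 1 + y^2. -/
lemma potential_le_of_excess (g R : ℝ) (z : Fin n → ℝ) :
    potential g R z ≤ 8 + 4 * excess 1 g R z := by
  unfold excess
  rw [pow_one]
  have := le_max_left (potential g R z / 4 - 1) 0
  have := le_max_right (potential g R z / 4 - 1) 0
  nlinarith [sq_nonneg (max (potential g R z / 4 - 1) 0 - 1)]

lemma exp_abs_le [NeZero n] {g R a : ℝ} (hg : 0 < g) (ha : 0 ≤ a)
    (hga : g * a ≤ 1 / 2) (hR : 0 ≤ R) (hgR : 1600000 * (g * R) ≤ 1) {z : Fin n → ℝ}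
    (hz : mean z = -a) (i : Fin n) :
    Real.exp (g * |z i|) ≤ 16 * n * potential g R z ^ 2 := by
  have h := expMean_add_expMean_neg_le hg ha hga hR hgR hz
  have h1 := exp_le_expMean g z i
  have h2 := exp_le_expMean (-g) z i
  have hn : (0 : ℝ) ≤ n := Nat.cast_nonneg n
  have hp := expMean_pos g z
  have hq := expMean_pos (-g) z
  have h3 : Real.exp (g * |z i|) ≤ n * (expMean g z + expMean (-g) z) := by
    rcases le_total 0 (z i) with h' | h'
    · rw [abs_of_nonneg h']; nlinarith
    · rw [abs_of_nonpos h', mul_neg, ← neg_mul]; nlinarith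
  refine h3.trans ?_
  calc _ ≤ n * (16 * potential g R z ^ 2) := by gcongr
    _ = _ := by ring

/-- If a bounded fraction of the bins is below the threshold, then the one-sided exponential
potential decreases. -/
lemma stepMean_expMean_le [NeZero n] {e : ℝ} (he : 0 < e) (he1 : e ≤ 1) {z : Fin n → ℝ}
    (hz : e ≤ fracBelow z) :
    stepMean z (fun k => expMean (e / 6) (shift z k)) ≤
      (1 - e ^ 2 / 12 / n) * expMean (e / 6) z + e ^ 2 / 12 / n * 2 := by
  have hn0 : (0 : ℝ) < n := Nat.cast_pos.2 (NeZero.pos n)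
  have hP := expMean_pos (e / 6) z
  have h1 := stepMean_relChange_pos_le (g := e / 6)
    (by rw [abs_of_pos (by positivity)]; linarith) z
  have h2 : e * (expMean (e / 6) z - 1) ≤ overDrop (e / 6) z := by
    rcases le_total 1 (expMean (e / 6) z) with h | h
    · have := le_overDrop (show 0 ≤ e / 6 by positivity) z
      nlinarith
    · have := overDrop_nonneg (show 0 ≤ e / 6 by positivity) z
      nlinarith
  simp_rw [expMean_shift]
  rw [stepMean_mul_left, stepMean_add, stepMean_const]
  set P := expMean (e / 6) z
  have h3 := mul_le_mul_of_nonneg_left h1 hP.le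
  have h4 : P * ((3 * (e / 6) ^ 2 - e / 6 * (overDrop (e / 6) z / P)) / n) =
      (3 * (e / 6) ^ 2 * P - e / 6 * overDrop (e / 6) z) / n := by
    field_simp
  have h5 : (3 * (e / 6) ^ 2 * P - e / 6 * overDrop (e / 6) z) / n ≤
      (3 * (e / 6) ^ 2 * P - e / 6 * (e * (P - 1))) / n := by
    gcongr
  -- The exponent e/6 makes the second-order cost 3 (e/6)^2 = e^2/12 half of the pull e^2/6.
  calc P * (1 + stepMean z fun k => relChange (e / 6) z k)
      ≤ P + (3 * (e / 6) ^ 2 * P - e / 6 * (e * (P - 1))) / n := by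
        change P * (1 + stepMean z (relChange (e / 6) z)) ≤ _
        linarith
    _ = _ := by ring

/-- If the exponential average below the threshold is bounded, then a bounded fraction of the
bins is below the threshold. -/
lemma sq_le_expMean_mul_fracBelow [NeZero n] {g a : ℝ} (hg : 0 ≤ g) (ha : 0 ≤ a)
    {z : Fin n → ℝ} (hz : mean z = -a) :
    (g * a) ^ 2 ≤ 2 * expMean (-g) z * fracBelow z := by
  have hn0 : (0 : ℝ) < n := Nat.cast_pos.2 (NeZero.pos n)
  have hN : a ≤ deficit z := by
    have := surplus_sub_deficit z
    have := surplus_nonneg z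
    linarith
  -- Second moment of the shortfall, from exp x ≥ x^2/2 for x ≥ 0.
  have h1 : mean (fun i => max (-z i) 0 ^ 2) * (g ^ 2 / 2) ≤ expMean (-g) z := by
    rw [mul_comm, ← mean_mul_left]
    refine mean_mono fun i => ?_
    rcases le_total (z i) 0 with h | h
    · rw [max_eq_left (by linarith)]
      have := Real.quadratic_le_exp_of_nonneg (x := -g * z i) (by nlinarith)
      nlinarith
    · rw [max_eq_right (by linarith)]
      have := Real.exp_pos (-g * z i)
      simpa using this.le
  have h2 : deficit z ^ 2 ≤ mean (fun i => max (-z i) 0 ^ 2) * fracBelow z := by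
    have h3 := Finset.sum_mul_sq_le_sq_mul_sq Finset.univ (fun i => max (-z i) 0) (below z)
    have h4 : ∀ i, max (-z i) 0 * below z i = max (-z i) 0 := by
      intro i; unfold below
      split_ifs with h
      · rw [mul_one]
      · rw [max_eq_right (by linarith)]; simp
    have h5 : ∀ i, below z i ^ 2 = below z i := by
      intro i; unfold below; split_ifs <;> norm_num
    simp_rw [h4, h5] at h3
    unfold deficit fracBelow mean
    rw [div_pow, div_mul_div_comm, ← sq]
    gcongr
  have h6 := fracBelow_nonneg z
  have h7 : a ^ 2 ≤ deficit z ^ 2 := pow_le_pow_left₀ ha hN 2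
  have h8 := mul_le_mul_of_nonneg_right h1 h6
  have h9 : g ^ 2 / 2 * a ^ 2 ≤
      g ^ 2 / 2 * (mean (fun i => max (-z i) 0 ^ 2) * fracBelow z) :=
    mul_le_mul_of_nonneg_left (h7.trans h2) (by positivity)
  nlinarith

/-- The drift of the product of a one-sided exponential potential with the damped two-sided
potential, before any case distinction. -/
lemma stepMean_expMean_mul_potential_le_drift [NeZero n] (hn : 2 ≤ n) {g R b : ℝ} (hg : 0 < g)
    (hg' : 100000 * g ≤ 1) (hR0 : 0 ≤ R) (hgR : 1600000 * (g * R) ≤ 1) (hb0 : 0 < b)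
    (hb : b ≤ 1 / 100) (z : Fin n → ℝ) :
    stepMean z (fun k => expMean b (shift z k) * potential g R (shift z k)) ≤
      expMean b z * potential g R z *
        (1 + (51 * b ^ 2 - b * (overDrop b z / expMean b z) + 240 * g ^ 2
          - g * (underDrop g z / expMean (-g) z)
          + g / 16 * ((1 - fracBelow z) * fracBelow z)) / n) := by
  have hn0 : (0 : ℝ) < n := Nat.cast_pos.2 (NeZero.pos n)
  have hbabs : |b| ≤ 1 := by rw [abs_of_pos hb0]; linarith
  have hW := potential_pos g R z
  have hP := expMean_pos b z
  set D : Fin n → ℝ := fun k => relChange b z k + totalChange g R z k with hD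
  have hstep : ∀ k, expMean b (shift z k) * potential g R (shift z k) ≤
      expMean b z * potential g R z * Real.exp (D k) := by
    intro k
    have := mul_le_mul (expMean_shift_le b z k) (potential_shift_le g R z k)
      (potential_pos g R _).le (mul_pos hP (Real.exp_pos _)).le
    refine this.trans (le_of_eq ?_)
    rw [hD, Real.exp_add]; ring
  have hu : ∀ k, |relChange b z k| ≤ 4 * b := by
    intro k
    have h1 := abs_relChange_le_share hbabs z k
    have h2 := share_le_one b z k
    have h3 : (1 : ℝ) / n ≤ 1 := by
      rw [div_le_one hn0]; exact_mod_cast NeZero.one_le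
    rw [abs_of_pos hb0] at h1
    nlinarith
  have hT : ∀ k, |totalChange g R z k| ≤ 9 * g := by
    intro k
    simpa using mul_abs_totalChange_le hg (by linarith) hR0 hgR zero_le_one (balanced_one g z) k
  have hDabs : ∀ k, |D k| ≤ 1 := fun k =>
    (abs_add_le _ _).trans (by linarith [hu k, hT k])
  have hu1 : stepMean z (fun k => |relChange b z k|) ≤ 6 * b / n := by
    refine (stepMean_mono z (abs_relChange_le_share hbabs z)).trans ?_
    rw [stepMean_mul_left, stepMean_add, stepMean_const, abs_of_pos hb0]
    have := stepMean_share_le b z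
    calc 2 * b * (stepMean z (share b z) + 1 / n) ≤ 2 * b * (2 / n + 1 / n) := by gcongr
      _ = _ := by ring
  have hD2 : stepMean z (fun k => D k ^ 2) ≤ (48 * b ^ 2 + 234 * g ^ 2) / n := by
    have h1 : ∀ k, D k ^ 2 ≤ 8 * b * |relChange b z k| + 2 * totalChange g R z k ^ 2 := by
      intro k
      have := mul_le_mul_of_nonneg_right (hu k) (abs_nonneg (relChange b z k))
      rw [← sq, sq_abs] at this
      have := sq_nonneg (relChange b z k - totalChange g R z k)
      rw [hD]; simp only; nlinarith
    refine (stepMean_mono z h1).trans ?_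
    rw [stepMean_add, stepMean_mul_left, stepMean_mul_left]
    have h2 := mul_stepMean_totalChange_sq_le hg (by linarith) hR0 hgR zero_le_one
      (balanced_one g z)
    rw [one_mul] at h2
    calc _ ≤ 8 * b * (6 * b / n) + 2 * (117 * g ^ 2 / n) := by gcongr
      _ = _ := by ring
  set d := fracBelow z with hd
  have hd0 : 0 ≤ d := fracBelow_nonneg z
  have hd1 : d ≤ 1 := fracBelow_le_one z
  set V := underDrop g z / expMean (-g) z with hV
  set U := overDrop b z / expMean b z with hU
  have hq := expMean_pos (-g) z
  have hD1 : stepMean z D ≤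
      (3 * b ^ 2 - b * U + 6 * g ^ 2 - g * V + g / 16 * ((1 - d) * d)) / n := by
    rw [hD, stepMean_add]
    have h1 := stepMean_relChange_pos_le hbabs z
    have h2 := stepMean_totalChange_le hn hg (by linarith) hR0 z
    -- The pull on overloaded bins at exponent g and the variance gain only help; both are dropped.
    have h3 : 6 * g ^ 2 - g * (overDrop g z / expMean g z) - g * (underDrop g z / expMean (-g) z)
        + 50000 * g ^ 2 * (2 * R * (1 - d) * d - nearMass R z / 8) ≤
        6 * g ^ 2 - g * V + g / 16 * ((1 - d) * d) := by
      have h4 : 0 ≤ g * (overDrop g z / expMean g z) :=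
        mul_nonneg hg.le (div_nonneg (overDrop_nonneg hg.le z) (expMean_pos g z).le)
      have h5 : 0 ≤ 50000 * g ^ 2 * (nearMass R z / 8) :=
        mul_nonneg (by positivity) (div_nonneg (nearMass_nonneg R z) (by norm_num))
      have h6 : g * (100000 * (g * R)) * ((1 - d) * d) ≤ g * (1 / 16) * ((1 - d) * d) := by
        have : 0 ≤ (1 - d) * d := mul_nonneg (by linarith) hd0
        gcongr; linarith
      nlinarith
    have h7 := h2.trans (div_le_div_of_nonneg_right h3 hn0.le)
    calc _ ≤ (3 * b ^ 2 - b * U) / n + (6 * g ^ 2 - g * V + g / 16 * ((1 - d) * d)) / n :=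
          add_le_add h1 h7
      _ = _ := by ring
  have hexp : stepMean z (fun k => Real.exp (D k)) ≤
      1 + (51 * b ^ 2 - b * U + 240 * g ^ 2 - g * V + g / 16 * ((1 - d) * d)) / n := by
    refine (stepMean_mono z fun k => exp_le_one_add_add_sq (hDabs k)).trans ?_
    rw [stepMean_add, stepMean_add, stepMean_const]
    calc _ ≤ 1 + (3 * b ^ 2 - b * U + 6 * g ^ 2 - g * V + g / 16 * ((1 - d) * d)) / n
          + (48 * b ^ 2 + 234 * g ^ 2) / n := by gcongr
      _ = _ := by ring
  refine (stepMean_mono z hstep).trans ?_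
  rw [stepMean_mul_left]
  exact mul_le_mul_of_nonneg_left hexp (mul_pos hP hW).le

/-- The bins below the threshold move towards it at a rate proportional to the fraction of bins
above it. -/
lemma le_underDrop_div [NeZero n] {g a : ℝ} (hg : 0 < g) (ha : 0 ≤ a) (hga : g * a ≤ 1 / 2)
    {z : Fin n → ℝ} (hz : mean z = -a) :
    (1 - fracBelow z) * (g * a) / 2 ≤ underDrop g z / expMean (-g) z := by
  have hq := expMean_pos (-g) z
  set d := fracBelow z with hd
  have hd1 : d ≤ 1 := fracBelow_le_one z
  rw [le_div_iff₀ hq]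
  rcases le_total 2 (expMean (-g) z) with h | h
  · have := le_underDrop hg.le z
    have h0 : 0 ≤ (1 - d) * expMean (-g) z := mul_nonneg (by linarith) hq.le
    nlinarith
  · have h1 := mul_deficit_le_underDrop hg.le z
    have h2 : a ≤ deficit z := by
      have := surplus_sub_deficit z
      have := surplus_nonneg z
      linarith
    have h3 : (1 - d) * (g * a) ≤ (1 - d) * (g * deficit z) := by
      have : 0 ≤ 1 - d := by linarith
      gcongr
    have h0 : 0 ≤ (1 - d) * (g * a) := mul_nonneg (by linarith) (by positivity)
    nlinarith

/-- The one-step recursion for the product of a one-sided exponential potential with a larger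
exponent and the damped two-sided potential. -/
lemma stepMean_expMean_mul_potential_le [NeZero n] (hn : 2 ≤ n) {g R a b : ℝ} (hg : 0 < g)
    (ha : 1920 ≤ a) (hga : g * a ≤ 1 / 2) (hR : 32000 * (a + 1) + 1 ≤ R)
    (hgR : 1600000 * (g * R) ≤ 1) (hgb : g ≤ b) (hb : b ≤ 1 / 100)
    (hbga : 408 * b ^ 2 ≤ g * (g * a)) {z : Fin n → ℝ} (hz : mean z = -a) :
    stepMean z (fun k => expMean b (shift z k) * potential g R (shift z k)) ≤
      (1 - g * (g * a) / 4 / n) * (expMean b z * potential g R z)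
        + 4 * g / n * potential g R z := by
  have hn0 : (0 : ℝ) < n := Nat.cast_pos.2 (NeZero.pos n)
  have hb0 : 0 < b := hg.trans_le hgb
  have hg' : 100000 * g ≤ 1 := by nlinarith
  have hR0 : 0 ≤ R := by linarith
  have hW := potential_pos g R z
  have hP := expMean_pos b z
  refine (stepMean_expMean_mul_potential_le_drift hn hg hg' hR0 hgR hb0 hb z).trans ?_
  have hV1 := le_underDrop_div hg (by linarith) hga hz
  set d := fracBelow z with hd
  have hd0 : 0 ≤ d := fracBelow_nonneg z
  have hd1 : d ≤ 1 := fracBelow_le_one z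
  set V := underDrop g z / expMean (-g) z with hV
  set U := overDrop b z / expMean b z with hU
  have hU0 : 0 ≤ U := div_nonneg (overDrop_nonneg hb0.le z) hP.le
  set c := g * a with hc
  have hc0 : 0 ≤ c := by nlinarith
  have hgc : 1920 * g ≤ c := by nlinarith
  -- Each term is at most g c/8, because 408 = 8 * 51 and 1920 = 8 * 240.
  have hsmall : 51 * b ^ 2 + 240 * g ^ 2 ≤ g * c / 4 := by
    have := mul_le_mul_of_nonneg_left hgc hg.le
    linarith
  have hgV : g * ((1 - d) * c / 2) ≤ g * V := mul_le_mul_of_nonneg_left hV1 hg.le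
  -- A large one-sided average pulls at rate b d/2 ≥ g d/2, which covers the part of g c lost when 1
  -- - d is small. A small one lets the positive terms pass into the additive term.
  rcases le_total 2 (expMean b z) with h | h
  · have hU1 : d / 2 ≤ U := by
      rw [hU, le_div_iff₀ hP]
      have := le_overDrop hb0.le z
      nlinarith
    have hbU : b * (d / 2) ≤ b * U := mul_le_mul_of_nonneg_left hU1 hb0.le
    have hgd : g * d ≤ b * d := mul_le_mul_of_nonneg_right hgb hd0
    have hbr : 51 * b ^ 2 - b * U + 240 * g ^ 2 - g * V + g / 16 * ((1 - d) * d) ≤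
        -(g * c / 4) := by
      have h1 : g * (d * c) ≤ g * (d * (1 / 2)) := by gcongr
      have h2 : 0 ≤ g * (d * d) := by positivity
      have h3 : 0 ≤ g * d := by positivity
      linarith
    have h2 := div_le_div_of_nonneg_right hbr hn0.le
    have h3 := mul_le_mul_of_nonneg_left h2 (mul_pos hP hW).le
    have h4 : 0 ≤ 4 * g / n * potential g R z := by positivity
    calc _ = expMean b z * potential g R z + expMean b z * potential g R z *
          ((51 * b ^ 2 - b * U + 240 * g ^ 2 - g * V + g / 16 * ((1 - d) * d)) / n) := by ring
      _ ≤ expMean b z * potential g R z + expMean b z * potential g R z * (-(g * c / 4) / n) := by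
        linarith
      _ = (1 - g * c / 4 / n) * (expMean b z * potential g R z) := by ring
      _ ≤ _ := by linarith
  · have hbr : 51 * b ^ 2 - b * U + 240 * g ^ 2 - g * V + g / 16 * ((1 - d) * d) ≤
        2 * g - g * c / 4 := by
      have h1 : 0 ≤ b * U := mul_nonneg hb0.le hU0
      have h2 : 0 ≤ g * V := le_trans
        (mul_nonneg hg.le (div_nonneg (mul_nonneg (by linarith) hc0) (by norm_num))) hgV
      have h3 : g * ((1 - d) * d) ≤ g * 1 :=
        mul_le_mul_of_nonneg_left (by nlinarith) hg.le
      have h4 : g * c ≤ g * (1 / 2) := by gcongr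
      linarith
    have h2 := div_le_div_of_nonneg_right hbr hn0.le
    have h3 := mul_le_mul_of_nonneg_left h2 (mul_pos hP hW).le
    have h4 : expMean b z * (2 * g / n * potential g R z) ≤ 2 * (2 * g / n * potential g R z) := by
      gcongr
    calc _ = expMean b z * potential g R z + expMean b z * potential g R z *
          ((51 * b ^ 2 - b * U + 240 * g ^ 2 - g * V + g / 16 * ((1 - d) * d)) / n) := by ring
      _ ≤ expMean b z * potential g R z +
          expMean b z * potential g R z * ((2 * g - g * c / 4) / n) := by linarith
      _ = (1 - g * c / 4 / n) * (expMean b z * potential g R z)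
          + expMean b z * (2 * g / n * potential g R z) := by ring
      _ ≤ (1 - g * c / 4 / n) * (expMean b z * potential g R z)
          + 2 * (2 * g / n * potential g R z) := by linarith
      _ = _ := by ring

end Bounds

/-! ### The process in relative loads; conditioning by resampling one round -/

section RelativeLoads

variable {n : ℕ}

/-- The bin that receives the ball, given the relative loads `z` and the samples. -/
noncomputable def pick (z : Fin n → ℝ) (i : Fin n × Fin n) : Fin n :=
  if z i.1 < 0 then i.1 else i.2

lemma sum_pick [NeZero n] (z g : Fin n → ℝ) :
    (∑ i, g (pick z i)) / (n : ℝ) ^ 2 = stepMean z g := by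
  have hn : (n : ℝ) ≠ 0 := Nat.cast_ne_zero.2 (NeZero.ne n)
  have h1 : ∀ i₁, ∑ i₂, g (pick z (i₁, i₂)) =
      n * (below z i₁ * g i₁) + (1 - below z i₁) * ∑ k, g k := by
    intro i₁
    unfold pick below
    split_ifs with h <;> simp
  rw [Fintype.sum_prod_type]
  simp_rw [h1]
  rw [Finset.sum_add_distrib, ← Finset.mul_sum, ← Finset.sum_mul, Finset.sum_sub_distrib]
  simp only [Finset.sum_const, Finset.card_univ, Fintype.card_fin, nsmul_eq_mul, mul_one]
  have h2 : ∑ i, below z i = n * fracBelow z := by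
    rw [fracBelow, mean]; field_simp
  have h3 : stepMean z g = (∑ k, below z k * g k + (1 - fracBelow z) * ∑ k, g k) / n := by
    unfold stepMean weight
    rw [Finset.mul_sum, ← Finset.sum_add_distrib, Finset.sum_div]
    exact Finset.sum_congr rfl fun k _ => by ring
  rw [h2, h3]
  field_simp

/-- The loads after `t` rounds, relative to the threshold `t / n + a`. -/
noncomputable def relLoad (a : ℝ) (t : ℕ) (s : Samples n) : Fin n → ℝ :=
  fun i => (relativeThreshold a s t i : ℝ) - t / n - a

lemma relativeThreshold_succ (a : ℝ) (t : ℕ) (s : Samples n) :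
    relativeThreshold a s (t + 1) =
      relativeThreshold a s t + Pi.single (pick (relLoad a t s) (s t)) 1 := by
  have h : relLoad a t s (s t).1 < 0 ↔
      (relativeThreshold a s t (s t).1 : ℝ) < (t : ℝ) / n + a := by
    unfold relLoad; constructor <;> intro h <;> linarith
  unfold pick
  simp only [h]
  change thinningStep _ _ _ = _
  unfold thinningStep
  change (if (relativeThreshold a s t (s t).1 : ℝ) < (t : ℝ) / n + a then
    relativeThreshold a s t + Pi.single (s t).1 1
    else relativeThreshold a s t + Pi.single (s t).2 1) = _
  split_ifs <;> rfl

lemma relLoad_zero (a : ℝ) (s : Samples n) : relLoad a 0 s = fun _ => -a := by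
  ext i; simp [relLoad, relativeThreshold, twoThinning]

lemma relLoad_succ (a : ℝ) (t : ℕ) (s : Samples n) :
    relLoad a (t + 1) s = shift (relLoad a t s) (pick (relLoad a t s) (s t)) := by
  ext i
  simp only [relLoad, shift, incr, relativeThreshold_succ, Pi.add_apply, Pi.single_apply]
  push_cast
  ring

lemma mean_relLoad [NeZero n] (a : ℝ) (t : ℕ) (s : Samples n) : mean (relLoad a t s) = -a := by
  induction t with
  | zero => rw [relLoad_zero, mean_const]
  | succ t ih => rw [relLoad_succ, mean_shift, ih]

/-- The loads after t rounds ignore the sample of round t, so averaging over that sample acts as a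
conditional expectation. -/
lemma relLoad_congr (a : ℝ) (t : ℕ) {s s' : Samples n} (h : ∀ j < t, s j = s' j) :
    relLoad a t s = relLoad a t s' := by
  induction t with
  | zero => rw [relLoad_zero, relLoad_zero]
  | succ t ih =>
    rw [relLoad_succ, relLoad_succ, ih fun j hj => h j (hj.trans t.lt_succ_self),
      h t t.lt_succ_self]

lemma relLoad_update (a : ℝ) {t u : ℕ} (hut : u ≤ t) (s : Samples n) (i : Fin n × Fin n) :
    relLoad a u (Function.update s t i) = relLoad a u s :=
  relLoad_congr a u fun j hj => Function.update_of_ne (by lia) _ _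

lemma relLoad_succ_update (a : ℝ) (t : ℕ) (s : Samples n) (i : Fin n × Fin n) :
    relLoad a (t + 1) (Function.update s t i) =
      shift (relLoad a t s) (pick (relLoad a t s) i) := by
  rw [relLoad_succ, relLoad_update a le_rfl, Function.update_self]

/-- Makes every real function of the relative loads at a fixed round bounded, hence integrable. -/
lemma finite_range_relLoad (a : ℝ) (t : ℕ) :
    (Set.range (relLoad (n := n) a t)).Finite := by
  induction t with
  | zero =>
    refine (Set.finite_singleton fun _ : Fin n => -a).subset ?_
    rintro _ ⟨s, rfl⟩
    exact relLoad_zero a s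
  | succ t ih =>
    refine (Set.Finite.image2 shift ih (Set.finite_univ (α := Fin n))).subset ?_
    rintro _ ⟨s, rfl⟩
    exact ⟨_, ⟨s, rfl⟩, _, Set.mem_univ _, (relLoad_succ a t s).symm⟩

lemma measurable_relativeThreshold (a : ℝ) (t : ℕ) :
    Measurable fun s : Samples n => relativeThreshold a s t := by
  induction t with
  | zero => exact measurable_const
  | succ t ih =>
    have h : Measurable fun p : LoadVector n × (Fin n × Fin n) =>
        thinningStep ((t : ℝ) / n + a) p.1 p.2 := measurable_of_countable _
    exact h.comp (ih.prodMk (measurable_pi_apply t))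

lemma measurable_comp_relLoad {β : Type*} [MeasurableSpace β] (a : ℝ) (t : ℕ)
    (f : (Fin n → ℝ) → β) : Measurable fun s : Samples n => f (relLoad a t s) := by
  have h : Measurable fun x : LoadVector n => f fun i => (x i : ℝ) - t / n - a :=
    measurable_of_countable _
  exact h.comp (measurable_relativeThreshold a t)

lemma exists_bound_comp_relLoad (a : ℝ) (t : ℕ) (f : (Fin n → ℝ) → ℝ) :
    ∃ C, 0 ≤ C ∧ ∀ s : Samples n, |f (relLoad a t s)| ≤ C := by
  obtain ⟨C, hC⟩ := ((finite_range_relLoad (n := n) a t).image fun z => |f z|).bddAbove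
  exact ⟨max C 0, le_max_right _ _, fun s =>
    (hC (Set.mem_image_of_mem _ (Set.mem_range_self s))).trans (le_max_left _ _)⟩

variable [NeZero n]

instance : IsProbabilityMeasure (sampleLaw n) := by
  unfold sampleLaw; infer_instance

/-- Resampling one round does not change the law of the samples. -/
lemma map_update_sampleLaw (t : ℕ) :
    ((sampleLaw n).prod (PMF.uniformOfFintype (Fin n × Fin n)).toMeasure).map
      (fun p : Samples n × (Fin n × Fin n) => Function.update p.1 t p.2) = sampleLaw n := by
  have hmeas : Measurable fun p : Samples n × (Fin n × Fin n) => Function.update p.1 t p.2 := by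
    rw [measurable_pi_iff]
    intro j
    by_cases hj : j = t
    · subst hj; simpa using measurable_snd
    · simp only [Function.update_of_ne hj]; exact (measurable_pi_apply j).comp measurable_fst
  refine Measure.eq_infinitePi _ fun I B hB => ?_
  rw [Measure.map_apply hmeas (MeasurableSet.pi I.countable_toSet fun i _ => hB i)]
  by_cases ht : t ∈ I
  · have h : (fun p : Samples n × (Fin n × Fin n) => Function.update p.1 t p.2) ⁻¹'
        (Set.pi I B) = (Set.pi (I.erase t) B) ×ˢ B t := by
      ext ⟨s, i⟩
      simp only [Set.mem_preimage, Set.mem_pi, Set.mem_prod, Finset.coe_erase, Set.mem_sdiff,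
        Finset.mem_coe, Set.mem_singleton_iff]
      constructor
      · intro h
        exact ⟨fun j hj => by simpa [hj.2] using h j hj.1, by simpa using h t ht⟩
      · rintro ⟨h1, h2⟩ j hj
        by_cases hjt : j = t
        · subst hjt; simpa using h2
        · simpa [hjt] using h1 j ⟨hj, hjt⟩
    rw [h, Measure.prod_prod, sampleLaw, Measure.infinitePi_pi _ fun i _ => hB i,
      Finset.prod_erase_mul _ _ ht]
  · have h : (fun p : Samples n × (Fin n × Fin n) => Function.update p.1 t p.2) ⁻¹'
        (Set.pi I B) = (Set.pi I B) ×ˢ Set.univ := by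
      ext ⟨s, i⟩
      simp only [Set.mem_preimage, Set.mem_pi, Set.mem_prod, Set.mem_univ, and_true,
        Finset.mem_coe]
      refine forall₂_congr fun j hj => ?_
      rw [Function.update_of_ne (by rintro rfl; exact ht hj)]
    rw [h, Measure.prod_prod, measure_univ, mul_one, sampleLaw,
      Measure.infinitePi_pi _ fun i _ => hB i]

lemma integral_uniform (g : Fin n × Fin n → ℝ) :
    ∫ i, g i ∂(PMF.uniformOfFintype (Fin n × Fin n)).toMeasure = (∑ i, g i) / (n : ℝ) ^ 2 := by
  rw [PMF.integral_eq_sum]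
  simp only [PMF.uniformOfFintype_apply, Fintype.card_prod, Fintype.card_fin, smul_eq_mul]
  rw [← Finset.mul_sum, div_eq_inv_mul]
  congr 1
  simp [sq]

/-- The expectation may be taken over one round first. -/
lemma integral_update {F : Samples n → ℝ} (hF : Measurable F) {C : ℝ} (hC : ∀ s, |F s| ≤ C)
    (t : ℕ) :
    ∫ s, F s ∂sampleLaw n =
      ∫ s, (∑ i, F (Function.update s t i)) / (n : ℝ) ^ 2 ∂sampleLaw n := by
  have hmeas : Measurable fun p : Samples n × (Fin n × Fin n) => Function.update p.1 t p.2 := by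
    rw [measurable_pi_iff]
    intro j
    by_cases hj : j = t
    · subst hj; simpa using measurable_snd
    · simp only [Function.update_of_ne hj]; exact (measurable_pi_apply j).comp measurable_fst
  conv_lhs => rw [← map_update_sampleLaw t]
  rw [integral_map hmeas.aemeasurable hF.aestronglyMeasurable, integral_prod]
  · exact integral_congr_ae (ae_of_all _ fun s => integral_uniform _)
  · exact Integrable.of_bound (hF.comp hmeas).aestronglyMeasurable C
      (ae_of_all _ fun p => by simpa using hC _)

end RelativeLoads

/-! ### Potentials killed on leaving a good set -/

section Killed

variable {n : ℕ}

/-- The relative loads stay in `G` during the rounds from `m` to `t`. -/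
def StaysIn (G : (Fin n → ℝ) → Prop) (a : ℝ) (m t : ℕ) (s : Samples n) : Prop :=
  ∀ u, m ≤ u → u ≤ t → G (relLoad a u s)

open Classical in
/-- The value of `V` after `t` rounds, killed when the relative loads leave `G`. -/
noncomputable def killed (G : (Fin n → ℝ) → Prop) (a : ℝ) (m t : ℕ) (V : (Fin n → ℝ) → ℝ)
    (s : Samples n) : ℝ := if StaysIn G a m t s then V (relLoad a t s) else 0

variable {G : (Fin n → ℝ) → Prop} {a : ℝ} {m t : ℕ} {V : (Fin n → ℝ) → ℝ}

lemma measurableSet_staysIn : MeasurableSet {s : Samples n | StaysIn G a m t s} := by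
  simp only [StaysIn, Set.ofPred_forall]
  refine MeasurableSet.iInter fun u => MeasurableSet.iInter fun _ =>
    MeasurableSet.iInter fun _ => ?_
  exact measurableSet_setOfPred.2 (measurable_comp_relLoad a u G)

lemma measurable_killed : Measurable (killed G a m t V) :=
  Measurable.ite measurableSet_staysIn (measurable_comp_relLoad a t V) measurable_const

lemma exists_bound_killed : ∃ C, ∀ s, |killed G a m t V s| ≤ C := by
  obtain ⟨C, hC0, hC⟩ := exists_bound_comp_relLoad a t V
  refine ⟨C, fun s => ?_⟩
  unfold killed
  split_ifs
  · exact hC s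
  · simpa using hC0

lemma killed_nonneg (hV : ∀ z, 0 ≤ V z) (s : Samples n) : 0 ≤ killed G a m t V s := by
  unfold killed; split_ifs
  · exact hV _
  · exact le_rfl

variable [NeZero n]

lemma integrable_killed : Integrable (killed G a m t V) (sampleLaw n) := by
  obtain ⟨C, hC⟩ := exists_bound_killed (G := G) (a := a) (m := m) (t := t) (V := V)
  exact Integrable.of_bound measurable_killed.aestronglyMeasurable C
    (ae_of_all _ fun s => by simpa using hC s)

/-- A one-step bound for the conditional expectation passes to expectations. -/
lemma integral_killed_succ_le (hV : ∀ z, 0 ≤ V z) {Q : (Fin n → ℝ) → ℝ} (hmt : m ≤ t)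
    (h : ∀ z, mean z = -a → G z → stepMean z (fun k => V (shift z k)) ≤ Q z) :
    ∫ s, killed G a m (t + 1) V s ∂sampleLaw n ≤ ∫ s, killed G a m t Q s ∂sampleLaw n := by
  obtain ⟨C, hC⟩ := exists_bound_killed (G := G) (a := a) (m := m) (t := t + 1) (V := V)
  rw [integral_update measurable_killed hC t]
  have hle : ∀ s, (∑ i, killed G a m (t + 1) V (Function.update s t i)) / (n : ℝ) ^ 2 ≤
      killed G a m t Q s := by
    intro s
    -- Survival up to round t does not see the sample of round t, so a path already killed
    -- contributes nothing after resampling.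
    have hprev : ∀ i, StaysIn G a m (t + 1) (Function.update s t i) → StaysIn G a m t s :=
      fun i hi u hu hut => by
        have := hi u hu (hut.trans t.le_succ)
        rwa [relLoad_update a hut] at this
    by_cases hs : StaysIn G a m t s
    · have h1 : ∀ i, killed G a m (t + 1) V (Function.update s t i) ≤
          V (shift (relLoad a t s) (pick (relLoad a t s) i)) := by
        intro i
        unfold killed
        rw [relLoad_succ_update]
        split_ifs
        · exact le_rfl
        · exact hV _
      calc _ ≤ (∑ i, V (shift (relLoad a t s) (pick (relLoad a t s) i))) / (n : ℝ) ^ 2 :=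
            div_le_div_of_nonneg_right (Finset.sum_le_sum fun i _ => h1 i) (by positivity)
        _ = stepMean (relLoad a t s) (fun k => V (shift (relLoad a t s) k)) :=
          sum_pick _ fun k => V (shift (relLoad a t s) k)
        _ ≤ Q (relLoad a t s) := h _ (mean_relLoad a t s) (hs t hmt le_rfl)
        _ = _ := by rw [killed, if_pos hs]
    · have h1 : ∀ i, killed G a m (t + 1) V (Function.update s t i) = 0 := fun i => by
        rw [killed, if_neg fun hi => hs (hprev i hi)]
      simp_rw [h1]; simp [killed, hs]
  refine integral_mono_of_nonneg (ae_of_all _ fun s => ?_) integrable_killed (ae_of_all _ hle)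
  exact div_nonneg (Finset.sum_nonneg fun i _ => killed_nonneg hV _) (by positivity)

/-- A potential that contracts towards `b` has expectation at most `b` plus the contracted initial
value. -/
lemma integral_killed_add_le (hV : ∀ z, 0 ≤ V z) {e b : ℝ} (he0 : 0 ≤ e) (he1 : e ≤ 1)
    (hb : 0 ≤ b)
    (h : ∀ z, mean z = -a → G z → stepMean z (fun k => V (shift z k)) ≤ (1 - e) * V z + e * b)
    (u : ℕ) :
    ∫ s, killed G a m (m + u) V s ∂sampleLaw n ≤
      (1 - e) ^ u * ∫ s, killed G a m m V s ∂sampleLaw n + b := by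
  induction u with
  | zero => simpa using hb
  | succ u ih =>
    have h1 := integral_killed_succ_le (m := m) (t := m + u) hV (by lia) h
    have h2 : ∫ s, killed G a m (m + u) (fun z => (1 - e) * V z + e * b) s ∂sampleLaw n ≤
        ∫ s, ((1 - e) * killed G a m (m + u) V s + e * b) ∂sampleLaw n := by
      refine integral_mono integrable_killed
        ((integrable_killed.const_mul _).add (integrable_const _)) fun s => ?_
      simp only [killed]
      split_ifs
      · exact le_rfl
      · rw [mul_zero, zero_add]; exact mul_nonneg he0 hb
    rw [integral_add (integrable_killed.const_mul _) (integrable_const _), integral_const_mul,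
      integral_const] at h2
    simp only [probReal_univ, smul_eq_mul, one_mul] at h2
    have h3 := mul_le_mul_of_nonneg_left ih (sub_nonneg.2 he1)
    calc _ ≤ _ := h1.trans h2
      _ ≤ (1 - e) * ((1 - e) ^ u * ∫ s, killed G a m m V s ∂sampleLaw n + b) + e * b := by
        linarith
      _ = _ := by ring

/-- If the potential starts below `c`, then a contraction towards `b` over enough rounds makes the
initial value irrelevant. -/
lemma integral_killed_le (hV : ∀ z, 0 ≤ V z) {e b : ℝ} (he0 : 0 ≤ e) (he1 : e ≤ 1)
    (hb : 0 ≤ b)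
    (h : ∀ z, mean z = -a → G z → stepMean z (fun k => V (shift z k)) ≤ (1 - e) * V z + e * b)
    {T : ℕ} {L : ℝ} (hL : ∀ z, mean z = -a → G z → V z ≤ Real.exp L) (hV0 : V (fun _ => -a) ≤ 1)
    (hT : L ≤ e * T) (hmt : m ≤ t) (ht : m + T ≤ t ∨ m = 0) :
    ∫ s, killed G a m t V s ∂sampleLaw n ≤ 1 + b := by
  obtain ⟨u, rfl⟩ := Nat.exists_eq_add_of_le hmt
  refine (integral_killed_add_le hV he0 he1 hb h u).trans (add_le_add_left ?_ b)
  have hpow : 0 ≤ (1 - e) ^ u := pow_nonneg (by linarith) u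
  have hint : ∀ c, 0 ≤ c → (∀ s : Samples n, G (relLoad a m s) → V (relLoad a m s) ≤ c) →
      ∫ s, killed G a m m V s ∂sampleLaw n ≤ c := by
    intro c hc hVc
    refine (integral_mono integrable_killed (integrable_const c) fun s => ?_).trans_eq (by simp)
    simp only [killed]
    split_ifs with hs
    · exact hVc s (hs m le_rfl le_rfl)
    · exact hc
  -- Either at least T rounds have passed and (1 - e)^u ≤ exp(-e T) cancels exp L, or the start is
  -- the empty vector with value at most 1.
  rcases ht with ht | rfl
  · have hTu : (T : ℝ) ≤ u := by exact_mod_cast (by lia : T ≤ u)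
    have h1 := hint (Real.exp L) (Real.exp_pos L).le fun s hs => hL _ (mean_relLoad a m s) hs
    have h2 : (1 - e) ^ u ≤ Real.exp (-(e * u)) := by
      have h3 : 1 - e ≤ Real.exp (-e) := by linarith [Real.add_one_le_exp (-e)]
      calc _ ≤ Real.exp (-e) ^ u := pow_le_pow_left₀ (by linarith) h3 u
        _ = _ := by rw [← Real.exp_nat_mul]; ring_nf
    calc _ ≤ Real.exp (-(e * u)) * Real.exp L :=
          (mul_le_mul_of_nonneg_left h1 hpow).trans
            (mul_le_mul_of_nonneg_right h2 (Real.exp_pos L).le)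
      _ ≤ 1 := by
          rw [← Real.exp_add, Real.exp_le_one_iff]
          have := mul_le_mul_of_nonneg_left hTu he0
          linarith
  · have h1 := hint 1 zero_le_one fun s _ => by rw [relLoad_zero]; exact hV0
    calc _ ≤ (1 - e) ^ u * 1 := mul_le_mul_of_nonneg_left h1 hpow
      _ ≤ 1 := by rw [mul_one]; exact pow_le_one₀ (by linarith) (by linarith)

/-- Markov's inequality. -/
lemma measureReal_staysIn_and_le (hV : ∀ z, 0 ≤ V z) {c K : ℝ} (hc : 0 < c)
    (hK : ∫ s, killed G a m t V s ∂sampleLaw n ≤ K) :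
    (sampleLaw n).real {s | StaysIn G a m t s ∧ c ≤ V (relLoad a t s)} ≤ K / c := by
  have h1 := mul_meas_ge_le_integral_of_nonneg (ae_of_all _ fun s => killed_nonneg hV s)
    (integrable_killed (G := G) (a := a) (m := m) (t := t) (V := V)) c
  rw [le_div_iff₀' hc]
  refine le_trans (mul_le_mul_of_nonneg_left (measureReal_mono ?_) hc.le) (h1.trans hK)
  rintro s ⟨hs, hcs⟩
  simpa [killed, hs] using hcs

end Killed

/-! ### Polynomial bounds at a fixed round; bounded offsets -/

section Moderate

variable {n : ℕ}

/-- The radius of the Huber potential for the offset `a`. -/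
noncomputable def radius (a : ℝ) : ℝ := 32001 * (a + 1)

/-- The exponents for which the potential with radius `radius a` contracts. -/
structure Admissible (g a : ℝ) : Prop where
  pos : 0 < g
  offset_nonneg : 0 ≤ a
  small : 10 ^ 11 * (g * (a + 1)) ≤ 1

namespace Admissible

variable {g a : ℝ}

lemma le_radius (h : Admissible g a) : 32000 * (a + 1) + 1 ≤ radius a := by
  have := h.offset_nonneg
  unfold radius; linarith

lemma radius_nonneg (h : Admissible g a) : 0 ≤ radius a := by
  have := h.offset_nonneg
  unfold radius; linarith

lemma mul_radius_le (h : Admissible g a) : 1600000 * (g * radius a) ≤ 1 := by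
  have := h.small
  have : 0 ≤ g * (a + 1) := mul_nonneg h.pos.le (by linarith [h.offset_nonneg])
  unfold radius; nlinarith

lemma mul_le (h : Admissible g a) : g * a ≤ 1 / 2 := by
  have := h.small
  have := mul_nonneg h.pos.le h.offset_nonneg
  have := h.pos
  nlinarith

lemma le_one (h : Admissible g a) : g ≤ 1 / 10 ^ 11 := by
  have := h.small
  have := mul_nonneg h.pos.le h.offset_nonneg
  rw [le_div_iff₀ (by norm_num)]
  linarith

end Admissible

lemma admissible_div {c a : ℝ} (hc : 0 < c) (hc' : 10 ^ 11 * c ≤ 1) (ha : 0 ≤ a) :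
    Admissible (c / (a + 1)) a where
  pos := div_pos hc (by linarith)
  offset_nonneg := ha
  small := by
    have : a + 1 ≠ 0 := by linarith
    rwa [div_mul_cancel₀ _ this]

variable [NeZero n]

lemma expMean_const (b x : ℝ) : expMean b (fun _ : Fin n => x) = Real.exp (b * x) :=
  mean_const _

lemma potential_initial_le {g a : ℝ} (h : Admissible g a) :
    potential g (radius a) (fun _ : Fin n => -a) ≤ 1 := by
  refine (potential_le g h.radius_nonneg _).trans_eq ?_
  rw [expMean_const, expMean_const, ← Real.exp_add]
  simp

lemma excess_initial {g a : ℝ} (h : Admissible g a) (th : ℕ) :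
    excess th g (radius a) (fun _ : Fin n => -a) = 0 := by
  have h1 : (potential g (radius a) (fun _ : Fin n => -a) / 4) ^ th ≤ 1 :=
    pow_le_one₀ (div_pos (potential_pos _ _ _) (by norm_num)).le
      (by linarith [potential_initial_le (n := n) h])
  rw [excess, max_eq_right (by linarith)]
  norm_num

/-- For the power 1 the balance condition always holds, so no killing is needed and the excess
starts at 0. -/
lemma integral_excess_le (hn : 2 ≤ n) {g a : ℝ} (h : Admissible g a) (t : ℕ) :
    ∫ s, killed (n := n) (fun _ => True) a 0 t (excess 1 g (radius a)) s ∂sampleLaw n ≤ 500 := by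
  have hn0 : (1 : ℝ) ≤ n := by exact_mod_cast NeZero.one_le
  have he1 : g ^ 2 / n ≤ 1 := by
    have h0 := h.pos
    have h1 := h.le_one
    rw [div_le_one (by linarith)]
    nlinarith
  have h1 := integral_killed_add_le (n := n) (G := fun _ => True) (a := a) (m := 0)
    (V := excess 1 g (radius a)) (e := g ^ 2 / n) (b := 500) (excess_nonneg _ _ _)
    (by positivity) he1 (by norm_num) (fun z hz _ => by
      simpa using stepMean_excess_le hn h.pos h.offset_nonneg h.le_radius h.mul_radius_le hz
        one_ne_zero (by simpa using balanced_one g z)) t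
  rw [zero_add] at h1
  refine h1.trans ?_
  have h2 : ∀ s : Samples n,
      killed (fun _ => True) a 0 0 (excess 1 g (radius a)) s = 0 := by
    intro s
    unfold killed
    rw [relLoad_zero, excess_initial h]
    simp
  simp [h2]

/-- The potential is polynomially small in `n` at any fixed round with high probability. -/
lemma measureReal_le_potential (hn : 2 ≤ n) {g a : ℝ} (h : Admissible g a) (t B : ℕ) :
    (sampleLaw n).real {s | 8 * (n : ℝ) ^ B ≤ potential g (radius a) (relLoad a t s)} ≤
      500 / (n : ℝ) ^ (2 * B) := by
  have hn0 : (1 : ℝ) ≤ n := by exact_mod_cast NeZero.one_le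
  have hnB : (1 : ℝ) ≤ (n : ℝ) ^ B := one_le_pow₀ hn0
  have h1 := measureReal_staysIn_and_le (n := n) (excess_nonneg 1 g (radius a))
    (c := (n : ℝ) ^ (2 * B)) (by positivity) (integral_excess_le hn h t)
  refine (measureReal_mono fun s hs => ?_).trans h1
  refine ⟨fun _ _ _ => trivial, ?_⟩
  have hs' : 8 * (n : ℝ) ^ B ≤ potential g (radius a) (relLoad a t s) := hs
  rw [excess, pow_one, mul_comm 2 B, pow_mul]
  refine pow_le_pow_left₀ (by positivity) ?_ 2
  refine le_trans ?_ (le_max_left _ _)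
  linarith

/-- A potential that is polynomially small in `n` bounds all loads. -/
lemma mul_abs_le_of_potential_lt (hn : 2 ≤ n) {g a : ℝ} (h : Admissible g a) {z : Fin n → ℝ}
    (hz : mean z = -a) {B : ℕ} (hW : potential g (radius a) z < 8 * (n : ℝ) ^ B) (i : Fin n) :
    g * |z i| ≤ (2 * B + 11) * Real.log n := by
  have hn0 : (2 : ℝ) ≤ n := by exact_mod_cast hn
  have h1 := exp_abs_le h.pos h.offset_nonneg h.mul_le h.radius_nonneg h.mul_radius_le hz i
  have h2 : potential g (radius a) z ^ 2 ≤ (8 * (n : ℝ) ^ B) ^ 2 :=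
    pow_le_pow_left₀ (potential_pos _ _ _).le hW.le 2
  -- The constant 16 * 8^2 = 2^10 is absorbed into n^10.
  have h3 : (2 : ℝ) ^ 10 ≤ (n : ℝ) ^ 10 := pow_le_pow_left₀ (by norm_num) hn0 10
  have h4 : Real.exp (g * |z i|) ≤ (n : ℝ) ^ (2 * B + 11) := by
    refine h1.trans ?_
    calc _ ≤ 16 * (n : ℝ) * (8 * (n : ℝ) ^ B) ^ 2 := by gcongr
      _ = 2 ^ 10 * ((n : ℝ) ^ (2 * B) * n) := by ring
      _ ≤ (n : ℝ) ^ 10 * ((n : ℝ) ^ (2 * B) * n) := by gcongr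
      _ = _ := by ring
  have h5 := Real.log_le_log (Real.exp_pos _) h4
  rw [Real.log_exp, Real.log_pow] at h5
  exact_mod_cast h5

/-- All loads are `O((a + 1) * log n)` above the threshold with high probability. -/
lemma measureReal_exists_lt_relLoad_le (hn : 2 ≤ n) {c a : ℝ} (hc : 0 < c)
    (hc' : 10 ^ 11 * c ≤ 1) (ha : 0 ≤ a) (t : ℕ) :
    (sampleLaw n).real {s | ∃ i, 25 / c * (a + 1) * Real.log n < relLoad a t s i} ≤
      1 / (n : ℝ) ^ 4 := by
  have hn0 : (2 : ℝ) ≤ n := by exact_mod_cast hn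
  have h := admissible_div hc hc' ha
  -- B = 7 gives loads up to (2 * 7 + 11) log n/g and failure probability 500/n^14.
  refine (measureReal_mono (fun s hs => ?_) (measure_ne_top _ _)).trans
    ((measureReal_le_potential hn h t 7).trans ?_)
  · obtain ⟨i, hi⟩ := hs
    by_contra hW
    have h1 := mul_abs_le_of_potential_lt hn h (mean_relLoad a t s) (not_le.1 hW) i
    have h2 : relLoad a t s i ≤ |relLoad a t s i| := le_abs_self _
    rw [div_mul_eq_mul_div, div_le_iff₀ (by linarith)] at h1
    have h3 : 25 / c * (a + 1) * Real.log n = 25 * Real.log n * (a + 1) / c := by ring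
    rw [h3, div_lt_iff₀ hc] at hi
    push_cast at h1
    nlinarith
  · have h3 : (500 : ℝ) ≤ (n : ℝ) ^ 10 :=
      le_trans (by norm_num) (pow_le_pow_left₀ (by norm_num) hn0 10)
    rw [div_le_div_iff₀ (by positivity) (by positivity)]
    calc _ ≤ (n : ℝ) ^ 10 * (n : ℝ) ^ 4 := by gcongr
      _ = _ := by ring

end Moderate

/-! ### Offsets of at least n - 1 -/

section LargeOffset

variable {n : ℕ} [NeZero n]

lemma one_div_four_le_potential {g a : ℝ} (h : Admissible g a) {z : Fin n → ℝ}
    (hz : mean z = -a) : 1 / 4 ≤ potential g (radius a) z := by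
  have h1 := expMean_add_expMean_neg_le h.pos h.offset_nonneg h.mul_le h.radius_nonneg
    h.mul_radius_le hz
  have h2 := one_le_expMean_neg h.pos.le h.offset_nonneg hz
  have h3 := expMean_pos g z
  have h4 := potential_pos g (radius a) z
  nlinarith

lemma integral_potential_le (hn : 2 ≤ n) {g a : ℝ} (h : Admissible g a) (t : ℕ) :
    ∫ s, killed (n := n) (fun _ => True) a 0 t (potential g (radius a)) s ∂sampleLaw n ≤
      2008 := by
  have h1 : ∫ s, killed (n := n) (fun _ => True) a 0 t (potential g (radius a)) s ∂sampleLaw n ≤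
      ∫ s, (8 + 4 * killed (n := n) (fun _ => True) a 0 t (excess 1 g (radius a)) s)
        ∂sampleLaw n := by
    refine integral_mono integrable_killed
      ((integrable_const _).add (integrable_killed.const_mul _)) fun s => ?_
    simp only [killed]
    split_ifs
    · exact potential_le_of_excess _ _ _
    · norm_num
  rw [integral_add (integrable_const _) (integrable_killed.const_mul _), integral_const_mul] at h1
  simp only [integral_const, probReal_univ, smul_eq_mul, one_mul] at h1
  linarith [integral_excess_le hn h t]

lemma integral_expMean_mul_potential_le (hn : 2 ≤ n) {g a b : ℝ} (h : Admissible g a)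
    (ha : 1920 ≤ a) (hgb : g ≤ b) (hb : b ≤ 1 / 100) (hbga : 408 * b ^ 2 ≤ g * (g * a)) (t : ℕ) :
    ∫ s, killed (n := n) (fun _ => True) a 0 t
      (fun z => expMean b z * potential g (radius a) z) s ∂sampleLaw n ≤ 32128 / (g * a) := by
  have hg := h.pos
  have hga : 0 < g * a := mul_pos hg (by linarith)
  have hga' := h.mul_le
  have hn0 : (2 : ℝ) ≤ n := by exact_mod_cast hn
  have hg1 : g ≤ 1 := h.le_one.trans (by norm_num)
  -- Fixed point of the recursion: g (g a)/4 * K = 4 g * 2008, with 2008 from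
  -- `integral_potential_le`.
  set K : ℝ := 32128 / (g * a) with hK
  have hKga : K * (g * a) = 32128 := div_mul_cancel₀ _ hga.ne'
  have hK1 : 1 ≤ K := by
    rw [hK, le_div_iff₀ hga]; linarith
  set V : (Fin n → ℝ) → ℝ := fun z => expMean b z * potential g (radius a) z with hV
  have hV0 : ∀ z, 0 ≤ V z := fun z => (mul_pos (expMean_pos b z) (potential_pos _ _ z)).le
  induction t with
  | zero =>
    refine (integral_mono integrable_killed (integrable_const K) fun s => ?_).trans_eq (by simp)
    simp only [killed]
    split_ifs
    · rw [relLoad_zero, hV]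
      simp only
      rw [expMean_const]
      refine (mul_le_one₀ ?_ (potential_pos _ _ _).le (potential_initial_le h)).trans hK1
      rw [Real.exp_le_one_iff]
      nlinarith
    · linarith
  | succ t ih =>
    have h1 := integral_killed_succ_le (n := n) (G := fun _ => True) (a := a) hV0 (Nat.zero_le t)
      (fun z hz _ => stepMean_expMean_mul_potential_le hn hg ha hga' h.le_radius h.mul_radius_le
        hgb hb hbga hz)
    have h2 : ∫ s, killed (n := n) (fun _ => True) a 0 t (fun z =>
          (1 - g * (g * a) / 4 / n) * (expMean b z * potential g (radius a) z)
            + 4 * g / n * potential g (radius a) z) s ∂sampleLaw n ≤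
        ∫ s, ((1 - g * (g * a) / 4 / n) * killed (fun _ => True) a 0 t V s
          + 4 * g / n * killed (fun _ => True) a 0 t (potential g (radius a)) s)
          ∂sampleLaw n := by
      refine integral_mono integrable_killed
        ((integrable_killed.const_mul _).add (integrable_killed.const_mul _)) fun s => ?_
      simp only [killed]
      split_ifs
      · exact le_rfl
      · simp
    rw [integral_add (integrable_killed.const_mul _) (integrable_killed.const_mul _),
      integral_const_mul, integral_const_mul] at h2
    refine h1.trans (h2.trans ?_)
    have h3 : 0 ≤ 1 - g * (g * a) / 4 / n := by
      have : g * (g * a) / 4 / n ≤ 1 := by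
        rw [div_le_one (by linarith)]
        nlinarith
      linarith
    have h4 : (0 : ℝ) ≤ 4 * g / n := by positivity
    have h5 := mul_le_mul_of_nonneg_left ih h3
    have h6 := mul_le_mul_of_nonneg_left (integral_potential_le hn h t) h4
    have h7 : g * (g * a) / 4 / n * K = 4 * g / n * 2008 := by
      rw [show g * (g * a) / 4 / n * K = g / 4 / n * (K * (g * a)) by ring, hKga]; ring
    nlinarith

/-- For an offset `a` of at least `n - 1`, all loads are `O(a)` with high probability. -/
lemma measureReal_exists_lt_relLoad_le_of_le_offset (hn : 2 ≤ n) {a : ℝ}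
    (ha : 1920 ≤ a) (hna : (n : ℝ) ≤ a + 1) (t : ℕ) :
    (sampleLaw n).real {s | ∃ i, 10 ^ 14 * a < relLoad a t s i} ≤ 1 / (n : ℝ) ^ 4 := by
  have hn0 : (2 : ℝ) ≤ n := by exact_mod_cast hn
  have h := admissible_div (c := 1 / 10 ^ 11) (by norm_num) (by norm_num)
    (show 0 ≤ a by linarith)
  set g : ℝ := 1 / 10 ^ 11 / (a + 1) with hg
  have hg0 : 0 < g := h.pos
  set x := √a with hx
  have hx2 : x ^ 2 = a := Real.sq_sqrt (by linarith)
  have hx43 : 43 ≤ x := Real.le_sqrt_of_sq_le (by linarith)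
  -- Of order g √a, as the recursion permits: 21^2 = 441 ≥ 408.
  set b : ℝ := g * (x / 21) with hb
  have hgb : g ≤ b := by rw [hb]; nlinarith
  have hbga : 408 * b ^ 2 ≤ g * (g * a) := by
    have : b ^ 2 = g * (g * a) / 441 := by rw [hb, ← hx2]; ring
    have : 0 ≤ g * (g * a) := by positivity
    linarith
  have hga1 : g * (a + 1) = 1 / 10 ^ 11 := div_mul_cancel₀ _ (by linarith)
  have hga0 : 1 / (2 * 10 ^ 11) ≤ g * a := by
    have : g * 1 ≤ g * a := by gcongr; linarith
    norm_num at hga1 ⊢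
    linarith
  have hb1 : b ≤ 1 / 100 := by
    have : b ≤ g * (a + 1) := by rw [hb]; gcongr; nlinarith
    norm_num at hga1 ⊢
    linarith
  have hb0 : 0 < b := hg0.trans_le hgb
  have h1 := measureReal_staysIn_and_le (n := n) (G := fun _ => True) (a := a) (m := 0) (t := t)
    (V := fun z => expMean b z * potential g (radius a) z)
    (fun z => (mul_pos (expMean_pos b z) (potential_pos _ _ z)).le)
    (c := Real.exp (b * (10 ^ 14 * a)) / (4 * n)) (by positivity)
    (integral_expMean_mul_potential_le hn h ha hgb hb1 hbga t)
  refine (measureReal_mono (fun s hs => ?_) (measure_ne_top _ _)).trans (h1.trans ?_)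
  · obtain ⟨i, hi⟩ := hs
    refine ⟨fun _ _ _ => trivial, ?_⟩
    have h2 := exp_le_expMean b (relLoad a t s) i
    have h3 := one_div_four_le_potential h (mean_relLoad a t s)
    have h4 : Real.exp (b * (10 ^ 14 * a)) ≤ n * expMean b (relLoad a t s) :=
      le_trans (Real.exp_le_exp.2 (by gcongr)) h2
    have h5 := expMean_pos b (relLoad a t s)
    rw [div_le_iff₀ (by positivity)]
    calc _ ≤ n * expMean b (relLoad a t s) * (4 * (1 / 4)) := by
          rw [show (4 : ℝ) * (1 / 4) = 1 by norm_num, mul_one]; exact h4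
      _ ≤ n * expMean b (relLoad a t s) * (4 * potential g (radius a) (relLoad a t s)) := by
        gcongr
      _ = _ := by ring
  · have hlog : Real.log n ≤ 3 * x := by
      have h2 : Real.log n ≤ Real.log ((2 * x) ^ 2) := by
        refine Real.log_le_log (by linarith) (hna.trans ?_)
        nlinarith
      rw [Real.log_pow] at h2
      have h3 : Real.log (2 * x) ≤ 2 * x - 1 := Real.log_le_sub_one_of_pos (by linarith)
      have h4 : Real.log (2 * x) = Real.log 2 + Real.log x :=
        Real.log_mul (by norm_num) (by linarith)
      have h5 : Real.log x ≤ x - 1 := Real.log_le_sub_one_of_pos (by linarith)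
      have h6 := Real.log_two_lt_d9
      push_cast at h2
      linarith
    -- The right side is at least (500/21) x, while 43 ≤ x and 5 log n ≤ 15 x.
    have hby : 43 + 5 * Real.log n ≤ b * (10 ^ 14 * a) := by
      have h2 : b * (10 ^ 14 * a) = g * a * (10 ^ 14 / 21) * x := by rw [hb]; ring
      have h3 : 1 / (2 * 10 ^ 11) * (10 ^ 14 / 21) * x ≤ g * a * (10 ^ 14 / 21) * x := by gcongr
      rw [h2]
      norm_num at h3 ⊢
      linarith
    have hexp : 4 * (64256 * 10 ^ 11) * (n : ℝ) ^ 5 ≤ Real.exp (b * (10 ^ 14 * a)) := by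
      refine le_trans ?_ (Real.exp_le_exp.2 hby)
      rw [Real.exp_add]
      have h2 : Real.exp (5 * Real.log n) = (n : ℝ) ^ 5 := by
        rw [show (5 : ℝ) * Real.log n = (5 : ℕ) * Real.log n by norm_num, Real.exp_nat_mul,
          Real.exp_log (by linarith)]
      rw [h2]
      gcongr
      have h3 : (2.7 : ℝ) ^ 43 ≤ Real.exp 43 := by
        rw [show (43 : ℝ) = (43 : ℕ) * 1 by norm_num, Real.exp_nat_mul]
        exact pow_le_pow_left₀ (by norm_num) (by linarith [Real.exp_one_gt_d9]) 43
      refine le_trans ?_ h3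
      norm_num
    have hK : 32128 / (g * a) ≤ 64256 * 10 ^ 11 := by
      rw [div_le_iff₀ (by positivity)]
      norm_num at hga0 ⊢
      linarith
    rw [div_div_eq_mul_div, div_le_div_iff₀ (Real.exp_pos _) (by positivity), one_mul]
    refine le_trans ?_ hexp
    calc _ ≤ 64256 * 10 ^ 11 * (4 * (n : ℝ)) * (n : ℝ) ^ 4 := by gcongr
      _ = _ := by ring

end LargeOffset

/-! ### Offsets of at most n - 1 with many bins -/

section SmallOffset

variable {n : ℕ} [NeZero n]

/-- With a fine exponent, the potential stays bounded with high probability, as long as the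
potential with a coarse exponent is polynomially small in `n`. -/
lemma measureReal_staysIn_and_le_potential (hn : 2 ≤ n) {g a : ℝ} (h : Admissible g a)
    (h' : Admissible (g / 42) a) {th : ℕ} (hth0 : th ≠ 0) (hth : (th : ℝ) ≤ √n / 2)
    {m t T : ℕ} (hT : 2 * n * Real.log n ≤ (g / 42) ^ 2 * T) (hmt : m ≤ t)
    (ht : m + T ≤ t ∨ m = 0) :
    (sampleLaw n).real {s | StaysIn (fun z => potential g (radius a) z < 8 * (n : ℝ) ^ 5) a m t s ∧
      8 ≤ potential (g / 42) (radius a) (relLoad a t s)} ≤ 501 / (2 ^ th - 1) ^ 2 := by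
  have hn0 : (2 : ℝ) ≤ n := by exact_mod_cast hn
  have hn00 : (0 : ℝ) < n := by linarith
  set G : (Fin n → ℝ) → Prop := fun z => potential g (radius a) z < 8 * (n : ℝ) ^ 5 with hG
  have hsq : √(n : ℝ) * √n = n := Real.mul_self_sqrt hn00.le
  have hsq0 : 0 < √(n : ℝ) := Real.sqrt_pos.2 hn00
  -- The coarse bound is g |z i| ≤ (2 * 5 + 11) log n = 21 log n; dividing by 42 leaves log √n.
  have hexp : ∀ z, mean z = -a → G z → ∀ i, Real.exp (g / 42 * |z i|) ≤ √n := by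
    intro z hz hGz i
    have h1 := mul_abs_le_of_potential_lt hn h hz hGz i
    rw [← Real.exp_log hsq0, Real.exp_le_exp, Real.log_sqrt hn00.le]
    push_cast at h1
    linarith
  have hexp1 : ∀ z, mean z = -a → G z → ∀ i, Real.exp (g / 42 * z i) ≤ √n :=
    fun z hz hGz i => (Real.exp_le_exp.2 (mul_le_mul_of_nonneg_left (le_abs_self _)
      h'.pos.le)).trans (hexp z hz hGz i)
  have hexp2 : ∀ z, mean z = -a → G z → ∀ i, Real.exp (-(g / 42) * z i) ≤ √n :=
    fun z hz hGz i => (Real.exp_le_exp.2 (by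
      have := mul_le_mul_of_nonneg_left (neg_abs_le (z i)) h'.pos.le
      linarith)).trans (hexp z hz hGz i)
  -- One bin contributes at most √n to sums of size at least n/2, so powers up to √n/2 are balanced.
  have hbal : ∀ z, mean z = -a → G z → Balanced th (g / 42) z := by
    intro z hz hGz
    have hp := one_half_le_expMean h'.mul_le hz
    have hq := one_le_expMean_neg h'.pos.le h'.offset_nonneg hz
    have hmul : ∀ x : ℝ, 0 ≤ x → x ≤ √n → (th : ℝ) * x ≤ n / 2 := fun x hx0 hx => by
      calc (th : ℝ) * x ≤ √n / 2 * √n := mul_le_mul hth hx hx0 (by positivity)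
        _ = _ := by rw [div_mul_eq_mul_div, hsq]
    refine ⟨hth.trans (by nlinarith), fun k => ⟨?_, ?_⟩⟩
    · have := hmul _ (Real.exp_pos _).le (hexp1 z hz hGz k)
      rw [share, ← mul_div_assoc, div_le_one (by positivity)]
      nlinarith
    · have := hmul _ (Real.exp_pos _).le (hexp2 z hz hGz k)
      rw [share, ← mul_div_assoc, div_le_one (by positivity)]
      nlinarith
  have hthn : (th : ℝ) ≤ n := by nlinarith
  have hth00 : (0 : ℝ) ≤ th := Nat.cast_nonneg th
  have hg1 : (g / 42) ^ 2 ≤ 1 :=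
    pow_le_one₀ h'.pos.le (h'.le_one.trans (by norm_num))
  have hint := integral_killed_le (n := n) (G := G) (a := a) (m := m) (t := t)
    (V := excess th (g / 42) (radius a)) (excess_nonneg _ _ _)
    (e := th * (g / 42) ^ 2 / n) (b := 500) (by positivity)
    (by rw [div_le_one hn00]; nlinarith [sq_nonneg (g / 42)]) (by norm_num)
    (fun z hz hGz => stepMean_excess_le hn h'.pos h'.offset_nonneg h'.le_radius h'.mul_radius_le
      hz hth0 (hbal z hz hGz)) (T := T) (L := 2 * th * Real.log n)
    (fun z hz hGz => by
      have hp0 := expMean_pos (g / 42) z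
      have hq0 := expMean_pos (-(g / 42)) z
      have hp : expMean (g / 42) z ≤ √n := (mean_mono (hexp1 z hz hGz)).trans_eq (mean_const _)
      have hq : expMean (-(g / 42)) z ≤ √n :=
        (mean_mono (hexp2 z hz hGz)).trans_eq (mean_const _)
      have hW : potential (g / 42) (radius a) z ≤ n := by
        refine (potential_le _ h'.radius_nonneg z).trans ?_
        rw [← hsq]
        exact mul_le_mul hp hq hq0.le hsq0.le
      have hW0 := potential_pos (g / 42) (radius a) z
      have h1 : (potential (g / 42) (radius a) z / 4) ^ th ≤ (n : ℝ) ^ th :=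
        pow_le_pow_left₀ (by positivity) (by linarith) th
      have h2 : max ((potential (g / 42) (radius a) z / 4) ^ th - 1) 0 ≤ (n : ℝ) ^ th :=
        max_le (by linarith) (by positivity)
      have h3 : Real.exp (2 * th * Real.log n) = ((n : ℝ) ^ th) ^ 2 := by
        rw [show 2 * (th : ℝ) * Real.log n = ((th * 2 : ℕ) : ℝ) * Real.log n by push_cast; ring,
          Real.exp_nat_mul, Real.exp_log hn00, pow_mul]
      rw [h3, excess]
      exact pow_le_pow_left₀ (le_max_right _ _) h2 2)
    (by rw [excess_initial h']; norm_num)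
    (by
      have h1 := mul_le_mul_of_nonneg_left hT (show 0 ≤ (th : ℝ) / n by positivity)
      calc 2 * (th : ℝ) * Real.log n = th / n * (2 * n * Real.log n) := by field_simp
        _ ≤ _ := h1
        _ = _ := by ring) hmt ht
  have h2th : (1 : ℝ) < 2 ^ th := one_lt_pow₀ (by norm_num) hth0
  have h1 := measureReal_staysIn_and_le (n := n) (excess_nonneg th (g / 42) (radius a))
    (c := ((2 : ℝ) ^ th - 1) ^ 2) (pow_pos (by linarith) 2)
    (hint.trans_eq (by norm_num : (1 : ℝ) + 500 = 501))
  refine (measureReal_mono ?_ (measure_ne_top _ _)).trans h1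
  intro s hs
  refine ⟨hs.1, ?_⟩
  rw [excess]
  refine pow_le_pow_left₀ (by linarith) (le_trans ?_ (le_max_left _ _)) 2
  have : (2 : ℝ) ^ th ≤ (potential (g / 42) (radius a) (relLoad a t s) / 4) ^ th :=
    pow_le_pow_left₀ (by norm_num) (by linarith [hs.2]) th
  linarith

/-- While the fine potential is bounded, the one-sided exponential potential contracts, so that
all loads are logarithmic. -/
lemma measureReal_staysIn_and_exists_lt (hn : 2 ≤ n) {g a e y : ℝ} (h : Admissible g a)
    (h' : Admissible (g / 42) a) (he : 0 < e) (he1 : e ≤ 1)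
    (hega : 2048 * e ≤ (g / 42 * a) ^ 2) {m t T : ℕ}
    (hT : 42 * n * Real.log n ≤ e * g * T) (hmt : m ≤ t) (ht : m + T ≤ t ∨ m = 0) :
    (sampleLaw n).real {s | StaysIn (fun z => potential g (radius a) z < 8 * (n : ℝ) ^ 5 ∧
        potential (g / 42) (radius a) z < 8) a m t s ∧ ∃ i, y < relLoad a t s i} ≤
      3 * n / Real.exp (e / 6 * y) := by
  have hn0 : (2 : ℝ) ≤ n := by exact_mod_cast hn
  have hn00 : (0 : ℝ) < n := by linarith
  set G : (Fin n → ℝ) → Prop := fun z => potential g (radius a) z < 8 * (n : ℝ) ^ 5 ∧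
    potential (g / 42) (radius a) z < 8 with hG
  -- The fine potential below 8 bounds `expMean (-(g / 42))` by 16 * 8^2 = 1024, whence 2048 = 2 *
  -- 1024.
  have hfrac : ∀ z, mean z = -a → G z → e ≤ fracBelow z := by
    intro z hz hGz
    have h1 := expMean_add_expMean_neg_le h'.pos h'.offset_nonneg h'.mul_le h'.radius_nonneg
      h'.mul_radius_le hz
    have h2 : potential (g / 42) (radius a) z ^ 2 ≤ 8 ^ 2 :=
      pow_le_pow_left₀ (potential_pos _ _ _).le hGz.2.le 2
    have h3 := sq_le_expMean_mul_fracBelow h'.pos.le h'.offset_nonneg hz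
    have h4 := expMean_pos (g / 42) z
    have h5 : 2 * expMean (-(g / 42)) z * fracBelow z ≤ 2 * 1024 * fracBelow z := by
      have := fracBelow_nonneg z
      gcongr
      linarith
    linarith
  have hV0 : ∀ z : Fin n → ℝ, 0 ≤ expMean (e / 6) z := fun z => (expMean_pos _ z).le
  have hint := integral_killed_le (n := n) (G := G) (a := a) (m := m) (t := t)
    (V := expMean (e / 6)) hV0 (e := e ^ 2 / 12 / n) (b := 2) (by positivity)
    (by rw [div_le_one hn00]; nlinarith) (by norm_num)
    (fun z hz hGz => stepMean_expMean_le he he1 (hfrac z hz hGz)) (T := T)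
    -- The coarse potential bounds every load at the start of the window by 21 log n/g.
    (L := e / 6 * (21 * Real.log n / g))
    (fun z hz hGz => by
      refine (mean_mono fun i => ?_).trans_eq (mean_const _)
      rw [Real.exp_le_exp]
      refine mul_le_mul_of_nonneg_left ?_ (by positivity)
      have h1 := mul_abs_le_of_potential_lt hn h hz hGz.1 i
      rw [le_div_iff₀ h.pos]
      push_cast at h1
      have h2 := mul_le_mul_of_nonneg_left (le_abs_self (z i)) h.pos.le
      linarith)
    (by
      rw [expMean_const, Real.exp_le_one_iff]
      nlinarith [h.offset_nonneg])
    (by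
      have hg := h.pos
      have h1 := mul_le_mul_of_nonneg_left hT (show 0 ≤ e / (12 * n * g) by positivity)
      calc e / 6 * (21 * Real.log n / g) = e / (12 * n * g) * (42 * n * Real.log n) := by
            field_simp; ring
        _ ≤ _ := h1
        _ = _ := by field_simp) hmt ht
  have h1 := measureReal_staysIn_and_le (n := n) hV0 (c := Real.exp (e / 6 * y) / n)
    (by positivity) (hint.trans_eq (by norm_num : (1 : ℝ) + 2 = 3))
  have h2 : 3 / (Real.exp (e / 6 * y) / n) = 3 * n / Real.exp (e / 6 * y) := by field_simp
  rw [h2] at h1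
  refine (measureReal_mono ?_ (measure_ne_top _ _)).trans h1
  intro s hs
  refine ⟨hs.1, ?_⟩
  obtain ⟨i, hi⟩ := hs.2
  rw [div_le_iff₀' hn00]
  refine le_trans (Real.exp_le_exp.2 ?_) (exp_le_expMean (e / 6) (relLoad a t s) i)
  gcongr

/-- For a large number of bins and an offset `a` below `n`, all loads are logarithmic with high
probability. -/
lemma exists_measureReal_exists_lt_relLoad_le :
    ∃ (K : ℝ) (N : ℕ), 0 < K ∧ ∀ (n : ℕ) [NeZero n], N ≤ n → ∀ a : ℝ, 1 ≤ a → a + 1 ≤ n →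
      ∀ t : ℕ, (sampleLaw n).real {s | ∃ i, K * Real.log n < relLoad a t s i} ≤
        1 / (n : ℝ) ^ 4 := by
  set c : ℝ := 1 / 10 ^ 11 with hc
  have hc0 : 0 < c := by positivity
  have hc1 : c ≤ 1 := by rw [hc]; norm_num
  -- For a ≥ 1, g a = c a/(a + 1) ≥ c/2, so (g/42) a ≥ c/84.
  set e : ℝ := (c / 84) ^ 2 / 2048 with he
  have he0 : 0 < e := by positivity
  have he1 : e ≤ 1 := by
    have : (c / 84) ^ 2 ≤ 1 := pow_le_one₀ (by positivity) (by linarith)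
    rw [he]; linarith
  set C : ℝ := 3528 / c ^ 2 + 42 / (e * c) + 4 with hC
  refine ⟨42 / e, ⌈C⌉₊ + 10 ^ 8, by positivity, fun n _ hN a ha han m => ?_⟩
  have hn8 : (10 : ℝ) ^ 8 ≤ n := by exact_mod_cast (le_trans (Nat.le_add_left _ _) hN)
  have hnC : C ≤ n := (Nat.le_ceil C).trans (by exact_mod_cast (le_trans (Nat.le_add_right _ _) hN))
  have hn00 : (0 : ℝ) < n := by linarith
  have hn2 : 2 ≤ n := by
    have : (2 : ℝ) ≤ n := by linarith
    exact_mod_cast this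
  set l := Real.log n with hl
  have hl1 : 1 ≤ l := by
    rw [hl, Real.le_log_iff_exp_le hn00]
    linarith [Real.exp_one_lt_d9]
  have hln : l ≤ n := (Real.log_le_sub_one_of_pos hn00).trans (by linarith)
  have hsqrt : 20 * l + 4 ≤ √n := by
    set x := √(√(n : ℝ)) with hx
    have hx2 : x ^ 2 = √n := Real.sq_sqrt (Real.sqrt_nonneg _)
    have hx4 : x ^ 4 = n := by
      rw [show x ^ 4 = (x ^ 2) ^ 2 by ring, hx2, Real.sq_sqrt hn00.le]
    have hx100 : 100 ≤ x := Real.le_sqrt_of_sq_le (Real.le_sqrt_of_sq_le (by linarith))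
    have hlx : l = 4 * Real.log x := by
      rw [hl, ← hx4, Real.log_pow]; norm_num
    have := Real.log_le_sub_one_of_pos (show 0 < x by linarith)
    rw [← hx2, hlx]
    nlinarith
  set th := ⌈10 * l⌉₊ with hth
  have hthl : 10 * l ≤ th := Nat.le_ceil _
  have hthu : (th : ℝ) ≤ √n / 2 := by
    have := (Nat.ceil_lt_add_one (show 0 ≤ 10 * l by linarith)).le
    linarith
  have hth0 : th ≠ 0 := by
    rintro h0
    rw [h0] at hthl
    push_cast at hthl
    linarith
  set g := c / (a + 1) with hg
  have ha1 : 0 < a + 1 := by linarith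
  have h : Admissible g a := admissible_div hc0 (by rw [hc]; norm_num) (by linarith)
  have h' : Admissible (g / 42) a := by
    have := admissible_div (c := c / 42) (by positivity) (by rw [hc]; norm_num)
      (show 0 ≤ a by linarith)
    rwa [div_right_comm] at this
  have hg0 := h.pos
  have hcg : c / n ≤ g := by rw [hg]; gcongr
  have hega : 2048 * e ≤ (g / 42 * a) ^ 2 := by
    rw [he, mul_div_cancel₀ _ (by norm_num)]
    refine pow_le_pow_left₀ (by positivity) ?_ 2
    have : c / 2 ≤ g * a := by
      rw [hg, div_mul_eq_mul_div, le_div_iff₀ ha1]; nlinarith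
    linarith
  set T₂ := ⌈2 * n * l / (g / 42) ^ 2⌉₊ with hT₂
  set T₃ := ⌈42 * n * l / (e * g)⌉₊ with hT₃
  have hT₂l : 2 * n * l ≤ (g / 42) ^ 2 * T₂ := by
    rw [← div_le_iff₀' (by positivity)]; exact Nat.le_ceil _
  have hT₃l : 42 * n * l ≤ e * g * T₃ := by
    rw [← div_le_iff₀' (by positivity)]; exact Nat.le_ceil _
  have hTu : (T₂ : ℝ) + T₃ + 1 ≤ (n : ℝ) ^ 5 := by
    have h2 : 2 * n * l / (g / 42) ^ 2 ≤ 3528 / c ^ 2 * (n : ℝ) ^ 4 := by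
      calc _ ≤ 2 * n * n / (c / n / 42) ^ 2 := by gcongr
        _ = _ := by field_simp; ring
    have h3 : 42 * n * l / (e * g) ≤ 42 / (e * c) * (n : ℝ) ^ 4 := by
      calc _ ≤ 42 * n * n / (e * (c / n)) := by gcongr
        _ = 42 / (e * c) * (n : ℝ) ^ 3 := by field_simp
        _ ≤ _ := by gcongr <;> [linarith; norm_num]
    have h4 : (T₂ : ℝ) ≤ _ :=
      (Nat.ceil_lt_add_one (show 0 ≤ 2 * n * l / (g / 42) ^ 2 by positivity)).le
    have h5 : (T₃ : ℝ) ≤ _ :=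
      (Nat.ceil_lt_add_one (show 0 ≤ 42 * n * l / (e * g) by positivity)).le
    have h6 : (1 : ℝ) ≤ (n : ℝ) ^ 4 := one_le_pow₀ (by linarith)
    calc (T₂ : ℝ) + T₃ + 1 ≤ C * (n : ℝ) ^ 4 := by rw [hC]; linarith
      _ ≤ n * (n : ℝ) ^ 4 := by gcongr
      _ = _ := by ring
  -- T₃ rounds let the one-sided average contract, T₂ earlier ones the fine potential. Truncated
  -- subtraction starts a window at round 0 when too few rounds exist; the known initial value then
  -- replaces the warm-up.
  set m₁ := m - T₃ with hm₁
  set m₀ := m₁ - T₂ with hm₀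
  set G₁ : (Fin n → ℝ) → Prop := fun z => potential g (radius a) z < 8 * (n : ℝ) ^ 5 with hG₁
  set A : ℕ → Set (Samples n) := fun t =>
    {s | 8 * (n : ℝ) ^ 5 ≤ potential g (radius a) (relLoad a t s)} with hA
  set B : ℕ → Set (Samples n) := fun t =>
    {s | StaysIn G₁ a m₀ t s ∧ 8 ≤ potential (g / 42) (radius a) (relLoad a t s)} with hB
  set D : Set (Samples n) := {s | StaysIn (fun z => potential g (radius a) z < 8 * (n : ℝ) ^ 5 ∧
        potential (g / 42) (radius a) z < 8) a m₁ m s ∧ ∃ i, 42 / e * l < relLoad a m s i} with hD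
  have hcover : {s : Samples n | ∃ i, 42 / e * l < relLoad a m s i} ⊆
      ((⋃ t ∈ Finset.Icc m₀ m, A t) ∪ ⋃ t ∈ Finset.Icc m₁ m, B t) ∪ D := by
    intro s hs
    by_contra hcon
    simp only [Set.mem_union, Set.mem_iUnion, Finset.mem_Icc, not_or, not_exists] at hcon
    obtain ⟨⟨hA', hB'⟩, hD'⟩ := hcon
    have h1 : ∀ t, m₀ ≤ t → t ≤ m → G₁ (relLoad a t s) := fun t h1 h2 =>
      not_le.1 (hA' t ⟨h1, h2⟩)
    refine hD' ⟨fun t ht1 ht2 => ⟨h1 t (by lia) ht2, ?_⟩, hs⟩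
    by_contra h8
    exact hB' t ⟨ht1, ht2⟩ ⟨fun u hu1 hu2 => h1 u hu1 (hu2.trans ht2), not_lt.1 h8⟩
  have hAp : ∀ t ∈ Finset.Icc m₀ m, (sampleLaw n).real (A t) ≤ 500 / (n : ℝ) ^ 10 := fun t _ =>
    measureReal_le_potential hn2 h t 5
  -- (2^th)^2 = 4^th ≥ e^th ≥ n^10, as th ≥ 10 log n.
  have hpow : (n : ℝ) ^ 10 / 4 ≤ ((2 : ℝ) ^ th - 1) ^ 2 := by
    have h1 : (2 : ℝ) ≤ 2 ^ th := le_self_pow₀ (by norm_num) hth0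
    have h2 : (n : ℝ) ^ 10 ≤ ((2 : ℝ) ^ th) ^ 2 := by
      have h3 : (n : ℝ) ^ 10 = Real.exp (10 * l) := by
        rw [show (10 : ℝ) * l = (10 : ℕ) * l by norm_num, Real.exp_nat_mul, hl, Real.exp_log hn00]
      have h4 : Real.exp th = Real.exp 1 ^ th := by rw [← Real.exp_nat_mul, mul_one]
      rw [h3, ← pow_mul, mul_comm th 2, pow_mul]
      refine (Real.exp_le_exp.2 hthl).trans ?_
      rw [h4]
      exact pow_le_pow_left₀ (Real.exp_pos _).le (by linarith [Real.exp_one_lt_d9]) th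
    nlinarith
  have hBp : ∀ t ∈ Finset.Icc m₁ m, (sampleLaw n).real (B t) ≤ 2004 / (n : ℝ) ^ 10 := by
    intro t ht
    rw [Finset.mem_Icc] at ht
    refine (measureReal_staysIn_and_le_potential hn2 h h' hth0 hthu hT₂l (by lia)
      (by lia)).trans ?_
    calc _ ≤ 501 / ((n : ℝ) ^ 10 / 4) := by gcongr
      _ = _ := by field_simp; norm_num
  have hDp : (sampleLaw n).real D ≤ 3 / (n : ℝ) ^ 6 := by
    refine (measureReal_staysIn_and_exists_lt hn2 h h' he0 he1 hega hT₃l (by lia) (by lia)).trans ?_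
    have h3 : Real.exp (e / 6 * (42 / e * l)) = (n : ℝ) ^ 7 := by
      rw [show e / 6 * (42 / e * l) = (7 : ℕ) * l by field_simp; norm_num, Real.exp_nat_mul, hl,
        Real.exp_log hn00]
    rw [h3]
    refine le_of_eq ?_
    field_simp
  have hcard : ∀ q : ℕ, m - T₂ - T₃ ≤ q → ((Finset.Icc q m).card : ℝ) ≤ (n : ℝ) ^ 5 := by
    intro q hq
    refine le_trans ?_ hTu
    rw [Nat.card_Icc]
    exact_mod_cast (by lia : m + 1 - q ≤ T₂ + T₃ + 1)
  have hsumA : (sampleLaw n).real (⋃ t ∈ Finset.Icc m₀ m, A t) ≤ 500 / (n : ℝ) ^ 5 := by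
    refine (measureReal_biUnion_finset_le _ _).trans ((Finset.sum_le_sum hAp).trans ?_)
    rw [Finset.sum_const, nsmul_eq_mul]
    calc _ ≤ (n : ℝ) ^ 5 * (500 / (n : ℝ) ^ 10) := by gcongr; exact hcard _ (by lia)
      _ = _ := by field_simp
  have hsumB : (sampleLaw n).real (⋃ t ∈ Finset.Icc m₁ m, B t) ≤ 2004 / (n : ℝ) ^ 5 := by
    refine (measureReal_biUnion_finset_le _ _).trans ((Finset.sum_le_sum hBp).trans ?_)
    rw [Finset.sum_const, nsmul_eq_mul]
    calc _ ≤ (n : ℝ) ^ 5 * (2004 / (n : ℝ) ^ 10) := by gcongr; exact hcard _ (by lia)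
      _ = _ := by field_simp
  refine (measureReal_mono hcover (measure_ne_top _ _)).trans ?_
  refine (measureReal_union_le _ _).trans ((add_le_add ((measureReal_union_le _ _).trans
    (add_le_add hsumA hsumB)) hDp).trans ?_)
  have h6 : 3 / (n : ℝ) ^ 6 ≤ 3 / (n : ℝ) ^ 5 := by
    gcongr <;> [linarith; norm_num]
  calc _ ≤ 500 / (n : ℝ) ^ 5 + 2004 / (n : ℝ) ^ 5 + 3 / (n : ℝ) ^ 5 := by linarith
    _ = 2507 / n * (1 / (n : ℝ) ^ 4) := by field_simp; norm_num
    _ ≤ 1 * (1 / (n : ℝ) ^ 4) := by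
      gcongr
      rw [div_le_one hn00]; linarith
    _ = _ := one_mul _

end SmallOffset

/-! ### From relative loads to the gap, and the union of the regimes -/

lemma gap_le_of_relLoad_le {n : ℕ} [NeZero n] {a y : ℝ} {t : ℕ} {s : Samples n}
    (h : ∀ i, relLoad a t s i ≤ y) : gap (relativeThreshold a s t) ≤ y + a := by
  have hn : (n : ℝ) ≠ 0 := Nat.cast_ne_zero.2 (NeZero.ne n)
  have hsum : ((∑ i, relativeThreshold a s t i : ℕ) : ℝ) / n = t / n := by
    have h1 : mean (relLoad a t s) =
        mean (fun i => (relativeThreshold a s t i : ℝ)) - t / n - a := by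
      unfold relLoad
      rw [mean_sub, mean_sub, mean_const, mean_const]
    rw [mean_relLoad, mean] at h1
    push_cast
    linarith
  obtain ⟨i, -, hi⟩ := Finset.exists_mem_eq_sup' Finset.univ_nonempty (relativeThreshold a s t)
  have h2 := h i
  unfold relLoad at h2
  rw [gap, hsum, hi]
  linarith

/-- All loads exceed the threshold by at most `O(log n + a)` with high probability. -/
lemma exists_measureReal_exists_lt_relLoad_le_log_add :
    ∃ K : ℝ, 0 < K ∧ ∀ (n : ℕ) [NeZero n], 2 ≤ n → ∀ a : ℝ, 0 ≤ a → ∀ t : ℕ,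
      (sampleLaw n).real {s | ∃ i, K * (Real.log n + a) < relLoad a t s i} ≤
        1 / (n : ℝ) ^ 4 := by
  obtain ⟨K, N, hK, hKN⟩ := exists_measureReal_exists_lt_relLoad_le
  set c : ℝ := 1 / 10 ^ 11 with hc
  have hc0 : 0 < c := by positivity
  have hc1 : 10 ^ 11 * c ≤ 1 := by rw [hc]; norm_num
  refine ⟨25 / c * (1921 + N) + 10 ^ 14 + K, by positivity, fun n _ hn a ha t => ?_⟩
  have hn0 : (2 : ℝ) ≤ n := by exact_mod_cast hn
  have hl : 0 ≤ Real.log n := Real.log_nonneg (by linarith)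
  have hc2 : 0 ≤ 25 / c := by positivity
  have hN0 : (0 : ℝ) ≤ N := Nat.cast_nonneg N
  have key : ∀ y, y ≤ (25 / c * (1921 + N) + 10 ^ 14 + K) * (Real.log n + a) →
      (sampleLaw n).real {s | ∃ i, y < relLoad a t s i} ≤ 1 / (n : ℝ) ^ 4 →
      (sampleLaw n).real {s | ∃ i, (25 / c * (1921 + N) + 10 ^ 14 + K) * (Real.log n + a) <
        relLoad a t s i} ≤ 1 / (n : ℝ) ^ 4 := by
    intro y hy hle
    refine (measureReal_mono ?_ (measure_ne_top _ _)).trans hle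
    rintro s ⟨i, hi⟩
    exact ⟨i, hy.trans_lt hi⟩
  -- Serves both a ≤ 1920 and the few bins n ≤ N, where a + 1 ≤ n keeps a bounded.
  have hmod : a + 1 ≤ 1921 + N → (sampleLaw n).real {s | ∃ i,
      (25 / c * (1921 + N) + 10 ^ 14 + K) * (Real.log n + a) < relLoad a t s i} ≤
        1 / (n : ℝ) ^ 4 := fun haN => by
    refine key _ ?_ (measureReal_exists_lt_relLoad_le hn hc0 hc1 ha t)
    have h1 : 25 / c * (a + 1) * Real.log n ≤ 25 / c * (1921 + N) * Real.log n := by gcongr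
    have h2 : 0 ≤ (10 ^ 14 + K) * (Real.log n + a) := by positivity
    have h3 : 0 ≤ 25 / c * (1921 + N) * a := by positivity
    linarith
  rcases le_total a 1920 with ha1 | ha1
  · exact hmod (by linarith)
  rcases le_total (n : ℝ) (a + 1) with han | han
  · refine key _ ?_ (measureReal_exists_lt_relLoad_le_of_le_offset hn ha1 han t)
    have h2 : 0 ≤ (25 / c * (1921 + N) + K) * (Real.log n + a) := by positivity
    linarith
  rcases le_total N n with hNn | hNn
  · refine key _ ?_ (hKN n hNn a (by linarith) han t)
    have h2 : 0 ≤ (25 / c * (1921 + N) + 10 ^ 14) * (Real.log n + a) := by positivity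
    have h3 : 0 ≤ K * a := by positivity
    linarith
  · refine hmod ?_
    have : (n : ℝ) ≤ N := by exact_mod_cast hNn
    linarith

end BalancedAllocation

theorem theorem3p3 :
    ∃ κ : ℝ, 0 < κ ∧
      ∀ f : ℕ → ℝ, (∀ n, 0 ≤ f n) →
        ∀ (n : ℕ) [NeZero n] (m : ℕ),
          1 - 1 / (n : ℝ) ^ 4 ≤
            (BalancedAllocation.sampleLaw n).real
              {s | BalancedAllocation.gap (BalancedAllocation.relativeThreshold (f n) s m) ≤
                κ * (Real.log n + f n)} := by
  obtain ⟨K, hK, h⟩ := BalancedAllocation.exists_measureReal_exists_lt_relLoad_le_log_add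
  refine ⟨K + 1, by positivity, fun f hf n _ m => ?_⟩
  have hn1 : 1 ≤ n := NeZero.one_le
  rcases hn1.eq_or_lt with rfl | hn
  -- For n = 1 the claimed lower bound is 0.
  · simp
  have hl : 0 ≤ Real.log n := Real.log_natCast_nonneg n
  have h1 := h n hn (f n) (hf n) m
  set A := {s : BalancedAllocation.Samples n | ∃ i, K * (Real.log n + f n) <
    BalancedAllocation.relLoad (f n) m s i} with hA
  set S := {s : BalancedAllocation.Samples n | BalancedAllocation.gap
    (BalancedAllocation.relativeThreshold (f n) s m) ≤ (K + 1) * (Real.log n + f n)} with hS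
  have hcover : Set.univ ⊆ S ∪ A := fun s _ => by
    by_cases hs : s ∈ A
    · exact Or.inr hs
    · refine Or.inl ((BalancedAllocation.gap_le_of_relLoad_le (y := K * (Real.log n + f n))
        fun i => ?_).trans (by linarith))
      by_contra! hi
      exact hs ⟨i, hi⟩
  have h2 : (1 : ℝ) ≤ (BalancedAllocation.sampleLaw n).real S +
      (BalancedAllocation.sampleLaw n).real A :=
    calc (1 : ℝ) = (BalancedAllocation.sampleLaw n).real Set.univ := probReal_univ.symm
      _ ≤ _ := (measureReal_mono hcover).trans (measureReal_union_le _ _)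
  linarith
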